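/- Let $k$ be an algebraically closed field of characteristic $p>0$ and let $H$ be a finite-dimensional pointed Hopf algebra over $k$ (every simple subcoalgebra is one-dimensional). Let $H_0$ be the coradical (the sum of the simple subcoalgebras) and $H_1=\Delta^{-1}(H\otimes H_0+H_0\otimes H)$. Assume that $H$ has rank one, i.e. $\dim_k (k\otimes_{H_0}H_1)=2$, where $k$ is an $H_0$-module through the counit, and that $H_1$ generates $H$ as an algebra. For a group-like element $g$ let $P_{g,1}=\{y\in H:\Delta(y)=y\otimes g+1\otimes y\}$. Let $a$ be the skew point of $H$, i.e. a group-like element with $P_{a,1}\setminus H_0\neq\emptyset$. Then exactly one of the following holds: (i) there are $x\in P_{a,1}\setminus H_0$, an integer $N\ge 1$ and a primitive $N$-th root of unity $q\in k$ with $axa^{-1}=qx$; (ii) $a\neq 1$ and there is $x\in P_{a,1}\setminus H_0$ with $axa^{-1}=x+(a-1)$. Suppose $axa^{-1}=qx$ for some $x\in P_{a,1}\setminus H_0$ and $q\in k$. If $q\ne1$, then $H$ is isomorphic to a Hopf algebra $H_R$ with $r=0$. If $q=1$, then $H$ is isomorphic to a Hopf algebra $H_F$. If (ii) holds, then $p$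 divides the order of $a$. Here $H_R$ and $H_F$ are the following Hopf algebras, in both of which $\Delta(g)=g\otimes g$, $\varepsilon(g)=1$, $S(g)=g^{-1}$ for $g\in G$, and $\Delta(x)=x\otimes a+1\otimes x$, $\varepsilon(x)=0$, $S(x)=-xa^{-1}$. *First type.* $R=(G,\chi,a,\alpha)$ consists of a finite group $G$, an element $a\in Z(G)$, a character $\chi:G\to k^*$ with $\chi(a)\ne1$, and $\alpha=(\alpha_{-1},\alpha_0,\dots,\alpha_{r-1})\in k^{r+1}$ with $r\ge0$. Let $N$ be the order of $\chi(a)$ and $n=Np^r$. It is required that $\alpha_{-1}=0$ if $a^n=1$; that $\alpha_i\neq0$ for some $i\ge0$ implies $a^{N(p^r-p^i)}=1$ and $\chi(g)^{N(p^r-p^i)}=1$ for all $g\in G$; and that $\alpha_{-1}\ne0$ implies $\chi(g)^n=1$ for all $g\in G$. Then $H_R$ is the algebra generated by $G$ and $x$ with basis $(gx^i)_{g\in G,\,0\le i\le n-1}$ and relations (besides those of $G$) $gxg^{-1}=\chi(g)x$ for $g\in G$ and $x^n=\alpha_{-1}(a^n-1)+\sum_{i=0}^{r-1}\alpha_ix^{Np^i}$.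 *Second type.* $F=(G,\chi,c,a,(\alpha_{-1},\alpha_0))$ consists of a finite group $G$, an element $a\in Z(G)$, a character $\chi:G\to k^*$ with $\chi(a)=1$, a map $c:G\to k$ with $c(hg)=\chi(g)c(h)+c(g)$ for all $g,h\in G$ and $c(a)=0$, and $\alpha_{-1},\alpha_0\in k$ with $\alpha_0\in\{0,1\}$ and with $\alpha_{-1}=0$ if $\alpha_0=0$. It is required, with equations in the group algebra $kG$, that if $\alpha_0=0$ then $c(g)(a^p-1)=0$ for all $g\in G$; and that if $\alpha_0=1$ then $a^p=a$, and $\chi(g)\in\mathbb F_p^*$ and $(\alpha_{-1}(\chi(g)-1)+c(g)^p-c(g))(a-1)=0$ for all $g\in G$. Then $H_F$ is the algebra generated by $G$ and $x$ with basis $(gx^i)_{g\in G,\,0\le i\le p-1}$ and relations (besides those of $G$) $gxg^{-1}=\chi(g)x+c(g)(a-1)$ for $g\in G$ and $x^p=\alpha_{-1}(a^p-1)+\alpha_0x$. -/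

import Mathlib

open scoped TensorProduct

universe u v w

namespace RankOne

/-! ## Coalgebra notions -/

section Coalgebras

variable (k : Type u) [Field k] (H : Type v) [Ring H] [HopfAlgebra k H]

/-- `V ⊗ W` as a subspace of `H ⊗ H`, for subspaces `V`, `W` of `H`. -/
noncomputable def tensorSub {k : Type u} [Field k] {H : Type v} [Ring H] [HopfAlgebra k H]
    (V W : Submodule k H) : Submodule k (H ⊗[k] H) :=
  LinearMap.range (TensorProduct.mapIncl V W)

/-- A subcoalgebra: a subspace `D` with `Δ(D) ⊆ D ⊗ D`. -/
def IsSubcoalgebra {k : Type u} [Field k] {H : Type v} [Ring H] [HopfAlgebra k H]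
    (D : Submodule k H) : Prop :=
  ∀ d ∈ D, Coalgebra.comul (R := k) d ∈ tensorSub D D

/-- A simple subcoalgebra: nonzero, with no subcoalgebras besides `0` and itself. -/
def IsSimpleSubcoalgebra {k : Type u} [Field k] {H : Type v} [Ring H] [HopfAlgebra k H]
    (D : Submodule k H) : Prop :=
  IsSubcoalgebra D ∧ D ≠ ⊥ ∧ ∀ E : Submodule k H, IsSubcoalgebra E → E ≤ D → E = ⊥ ∨ E = D

/-- The coradical `H₀`: the sum of the simple subcoalgebras. -/
def coradical : Submodule k H :=
  sSup {D : Submodule k H | IsSimpleSubcoalgebra D}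

/-- The coradical filtration: `H₀` is the coradical and
`H_{i+1} = Δ⁻¹(H ⊗ H_i + H₀ ⊗ H)`. -/
noncomputable def coradicalFiltration : ℕ → Submodule k H
  | 0 => coradical k H
  | i + 1 => Submodule.comap (Coalgebra.comul (R := k) (A := H))
      (tensorSub ⊤ (coradicalFiltration i) ⊔ tensorSub (coradical k H) ⊤)

/-- A Hopf algebra is pointed if all its simple subcoalgebras are one-dimensional. -/
def IsPointed : Prop :=
  ∀ D : Submodule k H, IsSimpleSubcoalgebra D → Module.finrank k D = 1

/-- The relations defining the balanced tensor product `k ⊗_{H₀} H₁` as a quotient of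
`k ⊗_k H₁`: the right action of `h ∈ H₀` on `k` is through the counit, the left action on `H₁`
is multiplication, and `s·h ⊗ y` is identified with `s ⊗ h y`.
(For pointed `H`, the coradical is a subalgebra and `h y` always lies in `H₁`.) -/
noncomputable def balancedRelations : Submodule k (k ⊗[k] coradicalFiltration k H 1) :=
  Submodule.span k {t | ∃ (s : k) (h : H) (y z : coradicalFiltration k H 1),
    h ∈ coradical k H ∧ (z : H) = h * (y : H) ∧
    t = (s * Coalgebra.counit (R := k) h) ⊗ₜ[k] y - s ⊗ₜ[k] z}

/-- A pointed Hopf algebra has rank `t` if `dim (k ⊗_{H₀} H₁) = t + 1`. -/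
def HasRank (t : ℕ) : Prop :=
  Module.finrank k ((k ⊗[k] coradicalFiltration k H 1) ⧸ balancedRelations k H) = t + 1

/-- `P_{g,h}`: the set of `(g,h)`-primitive elements, `Δ(y) = y ⊗ g + h ⊗ y`. -/
def skewPrimitives {k : Type u} [Field k] {H : Type v} [Ring H] [HopfAlgebra k H]
    (g h : GroupLike k H) : Set H :=
  {y | Coalgebra.comul (R := k) y = y ⊗ₜ[k] (g : H) + (h : H) ⊗ₜ[k] y}

/-- `P_{g,1} \ H₀`. -/
def nontrivialSkewPrimitives {k : Type u} [Field k] {H : Type v} [Ring H] [HopfAlgebra k H]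
    (g : GroupLike k H) : Set H :=
  skewPrimitives g 1 \ (coradical k H : Set H)

/-- A group-like element `g` is a skew point if `P_{g,1} \ H₀` is not empty. -/
def IsSkewPoint {k : Type u} [Field k] {H : Type v} [Ring H] [HopfAlgebra k H]
    (g : GroupLike k H) : Prop :=
  (nontrivialSkewPrimitives g).Nonempty

end Coalgebras

/-! ## Auxiliary identities -/

section Auxiliary

/-- The Gaussian binomial coefficient `binom(i+m, i)_q`. -/
def gaussBinom {k : Type u} [Field k] (q : k) : ℕ → ℕ → k
  | 0, _ => 1
  | _ + 1, 0 => 1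
  | i + 1, m + 1 => gaussBinom q i (m + 1) + q ^ (i + 1) * gaussBinom q (i + 1) m

def gaussInt {k : Type u} [Field k] (q : k) (n : ℕ) : k := ∑ j ∈ Finset.range n, q ^ j

def gaussFact {k : Type u} [Field k] (q : k) (n : ℕ) : k :=
  ∏ j ∈ Finset.range n, gaussInt q (j + 1)

theorem gaussInt_add {k : Type u} [Field k] (q : k) (i m : ℕ) :
    gaussInt q (i + m) = gaussInt q i + q ^ i * gaussInt q m := by
  simp [gaussInt, Finset.sum_range_add, Finset.mul_sum, pow_add]

theorem gaussBinom_mul_fact {k : Type u} [Field k] (q : k) (i m : ℕ) :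
    gaussBinom q i m * (gaussFact q i * gaussFact q m) = gaussFact q (i + m) := by
  induction i generalizing m with
  | zero => simp [gaussBinom, gaussFact]
  | succ i ihi =>
    induction m with
    | zero => simp [gaussBinom, gaussFact]
    | succ m ihm =>
      have h1 := ihi (m + 1)
      have e1 : gaussFact q (i + 1) = gaussFact q i * gaussInt q (i + 1) := by
        simp [gaussFact, Finset.prod_range_succ]
      have e2 : gaussFact q (m + 1) = gaussFact q m * gaussInt q (m + 1) := by
        simp [gaussFact, Finset.prod_range_succ]
      have e3 : gaussFact q (i + 1 + (m + 1)) =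
          gaussFact q (i + 1 + m) * gaussInt q ((i + 1) + (m + 1)) := by
        simp [gaussFact, Finset.prod_range_succ, ← add_assoc]
      have e4 : i + (m + 1) = i + 1 + m := by omega
      rw [e4] at h1
      rw [e3, gaussInt_add, gaussBinom, add_mul, mul_add]
      congr 1
      · rw [← h1, e1]; ring
      · rw [← ihm, e2]; ring

theorem gaussInt_ne_zero {k : Type u} [Field k] {q : k} {N : ℕ} (hq : IsPrimitiveRoot q N)
    {j : ℕ} (hj : 0 < j) (hjN : j < N) : gaussInt q j ≠ 0 := by
  intro h
  have h2 := geom_sum_mul q j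
  rw [gaussInt] at h
  rw [h, zero_mul] at h2
  exact hq.pow_ne_one_of_pos_of_lt hj.ne' hjN (sub_eq_zero.mp h2.symm)

theorem gaussFact_ne_zero {k : Type u} [Field k] {q : k} {N : ℕ} (hq : IsPrimitiveRoot q N)
    {j : ℕ} (hjN : j < N) : gaussFact q j ≠ 0 := by
  rw [gaussFact, Finset.prod_ne_zero_iff]
  intro i hi
  exact gaussInt_ne_zero hq (Nat.succ_pos i) (by have := Finset.mem_range.mp hi; omega)

theorem gaussBinom_eq_zero {k : Type u} [Field k] {q : k} {i m : ℕ}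
    (hq : IsPrimitiveRoot q (i + m)) (hi : 0 < i) (hm : 0 < m) : gaussBinom q i m = 0 := by
  have h := gaussBinom_mul_fact q i m
  have h0 : gaussFact q (i + m) = 0 := by
    rw [gaussFact, Finset.prod_eq_zero_iff]
    refine ⟨i + m - 1, Finset.mem_range.mpr (by omega), ?_⟩
    rw [Nat.sub_add_cancel (by omega)]
    exact hq.geom_sum_eq_zero (by omega)
  rw [h0] at h
  exact (mul_eq_zero.mp h).resolve_right
    (mul_ne_zero (gaussFact_ne_zero hq (by omega)) (gaussFact_ne_zero hq (by omega)))

theorem pow_mul_skew {k : Type u} [Field k] {B : Type v} [Ring B] [Algebra k B] {q : k} {X Y : B}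
    (h : Y * X = q • (X * Y)) (i : ℕ) : Y * X ^ i = q ^ i • (X ^ i * Y) := by
  induction i with
  | zero => simp
  | succ i ih =>
    rw [pow_succ, ← mul_assoc, ih, smul_mul_assoc, mul_assoc, h, mul_smul_comm, smul_smul,
      ← pow_succ, mul_assoc]

theorem gaussBinom_zero_right {k : Type u} [Field k] (q : k) (i : ℕ) : gaussBinom q i 0 = 1 := by
  cases i <;> simp [gaussBinom]

theorem gaussBinom_zero_left {k : Type u} [Field k] (q : k) (m : ℕ) : gaussBinom q 0 m = 1 := by
  simp [gaussBinom]

theorem skew_binomial {k : Type u} [Field k] {B : Type v} [Ring B] [Algebra k B] {q : k}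
    {X Y : B} (h : Y * X = q • (X * Y)) (n : ℕ) :
    (X + Y) ^ n = ∑ ij ∈ Finset.HasAntidiagonal.antidiagonal n,
      gaussBinom q ij.1 ij.2 • (X ^ ij.1 * Y ^ ij.2) := by
  induction n with
  | zero => simp [gaussBinom]
  | succ n ih =>
    rw [pow_succ', ih, add_mul, Finset.mul_sum, Finset.mul_sum]
    have hX : ∀ ij : ℕ × ℕ, X * (gaussBinom q ij.1 ij.2 • (X ^ ij.1 * Y ^ ij.2)) =
        gaussBinom q ij.1 ij.2 • (X ^ (ij.1 + 1) * Y ^ ij.2) := by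
      intro ij; rw [mul_smul_comm, ← mul_assoc, ← pow_succ']
    have hY : ∀ ij : ℕ × ℕ, Y * (gaussBinom q ij.1 ij.2 • (X ^ ij.1 * Y ^ ij.2)) =
        (q ^ ij.1 * gaussBinom q ij.1 ij.2) • (X ^ ij.1 * Y ^ (ij.2 + 1)) := by
      intro ij
      rw [mul_smul_comm, ← mul_assoc, pow_mul_skew h, smul_mul_assoc, smul_smul, mul_assoc,
        ← pow_succ', mul_comm]
    simp only [hX, hY]
    cases n with
    | zero => simp [Finset.Nat.sum_antidiagonal_succ, gaussBinom, add_comm]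
    | succ n =>
      rw [Finset.Nat.sum_antidiagonal_succ' (n := n),
        Finset.Nat.sum_antidiagonal_succ (n := n),
        Finset.Nat.sum_antidiagonal_succ (n := n + 1),
        Finset.Nat.sum_antidiagonal_succ' (n := n)]
      simp only [gaussBinom_zero_right, gaussBinom_zero_left, gaussBinom, add_smul,
        Finset.sum_add_distrib, pow_zero, one_mul, mul_one, one_smul]
      abel

theorem skew_add_pow {k : Type u} [Field k] {B : Type v} [Ring B] [Algebra k B] {q : k} {N : ℕ}
    (hN : 0 < N) (hq : IsPrimitiveRoot q N) {X Y : B} (h : Y * X = q • (X * Y)) :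
    (X + Y) ^ N = X ^ N + Y ^ N := by
  rw [skew_binomial h]
  have hne : ((0, N) : ℕ × ℕ) ≠ (N, 0) := by
    intro h; simp only [Prod.mk.injEq] at h; omega
  have hsub : ({(0, N), (N, 0)} : Finset (ℕ × ℕ)) ⊆ Finset.HasAntidiagonal.antidiagonal N := by
    intro z hz; simp only [Finset.mem_insert, Finset.mem_singleton] at hz
    rcases hz with rfl | rfl <;> simp
  rw [← Finset.sum_subset hsub, Finset.sum_pair hne]
  · have hg0 : gaussBinom q N 0 = 1 := gaussBinom_zero_right q N
    have hg1 : gaussBinom q 0 N = 1 := gaussBinom_zero_left q N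
    simp [hg0, hg1, add_comm]
  · rintro ⟨i, m⟩ him hz
    simp only [Finset.HasAntidiagonal.mem_antidiagonal] at him
    simp only [Finset.mem_insert, Finset.mem_singleton, Prod.mk.injEq, not_or, not_and] at hz
    subst him
    rw [gaussBinom_eq_zero hq (by omega) (by omega), zero_smul]

theorem frobenius_add_pow {k : Type u} [Field k] (p : ℕ) [Fact p.Prime] [CharP k p]
    {B : Type v} [Ring B] [Algebra k B] {X Y : B} (h : Commute X Y) (r : ℕ) :
    (X + Y) ^ p ^ r = X ^ p ^ r + Y ^ p ^ r := by
  cases subsingleton_or_nontrivial B with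
  | inl _ => exact Subsingleton.elim _ _
  | inr _ =>
    have : CharP B p := charP_of_injective_algebraMap (algebraMap k B).injective p
    exact add_pow_char_pow_of_commute _ _ h

/-- `(X + Y)^(N p^r) = X^(N p^r) + Y^(N p^r)` if `YX = qXY` with `q` a primitive `N`-th root of
unity, in characteristic `p`. -/
theorem skew_add_pow_mul {k : Type u} [Field k] (p : ℕ) [Fact p.Prime] [CharP k p]
    {B : Type v} [Ring B] [Algebra k B] {q : k} {N : ℕ} (hN : 0 < N) (hq : IsPrimitiveRoot q N)
    {X Y : B} (h : Y * X = q • (X * Y)) (r : ℕ) :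
    (X + Y) ^ (N * p ^ r) = X ^ (N * p ^ r) + Y ^ (N * p ^ r) := by
  have hc : Commute (X ^ N) (Y ^ N) := by
    have h1 : Y * X ^ N = X ^ N * Y := by rw [pow_mul_skew h, hq.pow_eq_one, one_smul]
    have h2 : Commute (X ^ N) Y := h1.symm
    exact h2.pow_right N
  rw [pow_mul, skew_add_pow hN hq h, frobenius_add_pow (k := k) p hc, pow_mul, pow_mul]

theorem skew_mul_pow {k : Type u} [Field k] {B : Type v} [Ring B] [Algebra k B] {q : k}
    {X Y : B} (h : Y * X = q • (X * Y)) (n : ℕ) :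
    (X * Y) ^ n = (∏ j ∈ Finset.range n, q ^ j) • (X ^ n * Y ^ n) := by
  induction n with
  | zero => simp
  | succ n ih =>
    have hY : ∀ m, Y ^ m * X = q ^ m • (X * Y ^ m) := by
      intro m
      induction m with
      | zero => simp
      | succ m ihm =>
        rw [pow_succ', mul_assoc, ihm, mul_smul_comm, ← mul_assoc, h, smul_mul_assoc, smul_smul,
          mul_assoc, ← pow_succ', ← pow_succ]
    rw [pow_succ, ih, Finset.prod_range_succ, smul_mul_assoc, mul_assoc, ← mul_assoc (Y ^ n), hY,
      smul_mul_assoc, mul_smul_comm, smul_smul, mul_assoc X, ← pow_succ, ← mul_assoc (X ^ n),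
      ← pow_succ]

theorem neg_one_pow_mul_prod {k : Type u} [Field k] {q : k} {N : ℕ} (hN : 0 < N)
    (hq : IsPrimitiveRoot q N) : (-1) ^ N * ∏ j ∈ Finset.range N, q ^ j = -1 := by
  have : NeZero N := ⟨hN.ne'⟩
  have h := X_pow_sub_C_eq_prod hq hN (one_pow N : (1 : k) ^ N = 1)
  have h0 := congrArg (Polynomial.eval 0) h
  rw [Polynomial.eval_prod] at h0
  simp [hN.ne', Finset.prod_neg] at h0
  exact h0.symm

end Auxiliary


/-! ## The Hopf algebra generated by a group and one skew primitive element -/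

/-- Parameters for a Hopf algebra generated by a group `G` and an element `x` with
`g x g⁻¹ = χ(g) x + c(g) (a - 1)`,
`x ^ (N p^r) = α₋₁ (a ^ (N p^r) - 1) + ∑_{i < r} α_i x ^ (N p^i)` and
`Δ(x) = x ⊗ a + 1 ⊗ x`, together with the conditions under which the coalgebra structure is
compatible with these relations. -/
structure Datum (k : Type u) [Field k] (p : ℕ) (G : Type w) [Group G] where
  a : G
  a_central : a ∈ Subgroup.center G
  χ : G →* kˣ
  c : G → k
  c_a : c a = 0
  N : ℕ
  N_pos : 0 < N
  primitive : IsPrimitiveRoot (χ a : k) N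
  r : ℕ
  αneg : k
  α : Fin r → k
  torsion : ∀ i, α i ≠ 0 → a ^ (N * p ^ (i : ℕ)) = a ^ (N * p ^ r)

namespace Datum

variable {k : Type u} [Field k] {p : ℕ} {G : Type w} [Group G]

/-- The exponent `n = N p^r`. -/
def n (D : Datum k p G) : ℕ := D.N * p ^ D.r

/-- The free algebra on the generators: `some g` for `g ∈ G`, and `none` for `x`. -/
abbrev Free (_D : Datum k p G) : Type (max u w) := FreeAlgebra k (Option G)

def fgrp (D : Datum k p G) (g : G) : D.Free := FreeAlgebra.ι k (some g)

def fx (D : Datum k p G) : D.Free := FreeAlgebra.ι k none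

/-- The defining relations. -/
inductive Rel (D : Datum k p G) : D.Free → D.Free → Prop
  | one : Rel D (D.fgrp 1) 1
  | mul (g h : G) : Rel D (D.fgrp (g * h)) (D.fgrp g * D.fgrp h)
  | conj (g : G) : Rel D (D.fgrp g * D.fx * D.fgrp g⁻¹)
      ((D.χ g : k) • D.fx + D.c g • (D.fgrp D.a - 1))
  | pow : Rel D (D.fx ^ D.n)
      (D.αneg • (D.fgrp (D.a ^ D.n) - 1) + ∑ i, D.α i • D.fx ^ (D.N * p ^ (i : ℕ)))

/-- The algebra presented by the generators `G`, `x` and the defining relations. -/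
def Alg (D : Datum k p G) : Type (max u w) := RingQuot D.Rel

noncomputable instance (D : Datum k p G) : Ring D.Alg := inferInstanceAs (Ring (RingQuot D.Rel))

noncomputable instance (D : Datum k p G) : Algebra k D.Alg :=
  inferInstanceAs (Algebra k (RingQuot D.Rel))

noncomputable def proj (D : Datum k p G) : D.Free →ₐ[k] D.Alg := RingQuot.mkAlgHom k D.Rel

theorem proj_surjective (D : Datum k p G) : Function.Surjective D.proj :=
  RingQuot.mkAlgHom_surjective k D.Rel

/-- The image of `G` in the algebra. -/
noncomputable def grp (D : Datum k p G) : G →* D.Alg where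
  toFun g := D.proj (D.fgrp g)
  map_one' := by
    rw [← map_one D.proj]; exact RingQuot.mkAlgHom_rel k Rel.one
  map_mul' g h := by
    rw [← map_mul D.proj]; exact RingQuot.mkAlgHom_rel k (Rel.mul g h)

/-- The generator `x`. -/
noncomputable def x (D : Datum k p G) : D.Alg := D.proj D.fx

theorem conj_x (D : Datum k p G) (g : G) :
    D.grp g * D.x * D.grp g⁻¹ = (D.χ g : k) • D.x + D.c g • (D.grp D.a - 1) := by
  have h : D.proj _ = D.proj _ := RingQuot.mkAlgHom_rel k (Rel.conj (D := D) g)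
  simp only [map_add, map_sub, map_mul, map_smul, map_one] at h
  exact h

theorem x_pow (D : Datum k p G) :
    D.x ^ D.n = D.αneg • (D.grp (D.a ^ D.n) - 1) + ∑ i, D.α i • D.x ^ (D.N * p ^ (i : ℕ)) := by
  have h : D.proj _ = D.proj _ := RingQuot.mkAlgHom_rel k (Rel.pow (D := D))
  simp only [map_add, map_sub, map_pow D.proj, map_smul, map_sum, map_one] at h
  exact h

/-- The universal property of the presented algebra. -/
noncomputable def lift (D : Datum k p G) {B : Type*} [Ring B] [Algebra k B] (f : G →* B) (y : B)
    (hconj : ∀ g, f g * y * f g⁻¹ = (D.χ g : k) • y + D.c g • (f D.a - 1))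
    (hpow : y ^ D.n = D.αneg • (f (D.a ^ D.n) - 1) + ∑ i, D.α i • y ^ (D.N * p ^ (i : ℕ))) :
    D.Alg →ₐ[k] B :=
  RingQuot.liftAlgHom k ⟨FreeAlgebra.lift k (fun o => o.elim y f), by
    intro u v h
    cases h with
    | one => simp [fgrp]
    | mul g h => simp [fgrp]
    | conj g => simpa [fgrp, fx] using hconj g
    | pow => simpa [fgrp, fx] using hpow⟩

section lift

variable (D : Datum k p G) {B : Type*} [Ring B] [Algebra k B] (f : G →* B) (y : B)
    (hconj : ∀ g, f g * y * f g⁻¹ = (D.χ g : k) • y + D.c g • (f D.a - 1))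
    (hpow : y ^ D.n = D.αneg • (f (D.a ^ D.n) - 1) + ∑ i, D.α i • y ^ (D.N * p ^ (i : ℕ)))

theorem lift_proj (z : D.Free) : D.lift f y hconj hpow (D.proj z) =
    FreeAlgebra.lift k (fun o : Option G => o.elim y f) z :=
  RingQuot.liftAlgHom_mkAlgHom_apply k _ _ z

@[simp]
theorem lift_grp (g : G) : D.lift f y hconj hpow (D.grp g) = f g :=
  (D.lift_proj f y hconj hpow (D.fgrp g)).trans (by simp [fgrp])

@[simp]
theorem lift_x : D.lift f y hconj hpow D.x = y :=
  (D.lift_proj f y hconj hpow D.fx).trans (by simp [fx])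

end lift

theorem induction (D : Datum k p G) {P : D.Alg → Prop}
    (algebraMap : ∀ s : k, P (algebraMap k D.Alg s)) (grp : ∀ g, P (D.grp g)) (x : P D.x)
    (add : ∀ u v, P u → P v → P (u + v)) (mul : ∀ u v, P u → P v → P (u * v)) (z : D.Alg) :
    P z := by
  obtain ⟨w, rfl⟩ := D.proj_surjective z
  induction w using FreeAlgebra.induction with
  | grade0 s => rw [AlgHom.commutes]; exact algebraMap s
  | grade1 o =>
    cases o with
    | none => exact x
    | some g => exact grp g
  | add u v hu hv => rw [map_add]; exact add _ _ hu hv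
  | mul u v hu hv => rw [map_mul]; exact mul _ _ hu hv

theorem algHom_ext (D : Datum k p G) {B : Type*} [Semiring B] [Algebra k B] {φ ψ : D.Alg →ₐ[k] B}
    (hg : ∀ g, φ (D.grp g) = ψ (D.grp g)) (hx : φ D.x = ψ D.x) : φ = ψ := by
  ext z
  induction z using D.induction with
  | algebraMap s => simp
  | grp g => exact hg g
  | x => exact hx
  | add u v hu hv => rw [map_add, map_add, hu, hv]
  | mul u v hu hv => rw [map_mul, map_mul, hu, hv]

theorem grp_mul_inv (D : Datum k p G) (g : G) : D.grp g * D.grp g⁻¹ = 1 := by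
  rw [← map_mul]; simp

theorem grp_inv_mul (D : Datum k p G) (g : G) : D.grp g⁻¹ * D.grp g = 1 := by
  rw [← map_mul]; simp

theorem conj_a (D : Datum k p G) (g : G) : D.grp g * D.grp D.a * D.grp g⁻¹ = D.grp D.a := by
  rw [← map_mul, ← map_mul, Subgroup.mem_center_iff.mp D.a_central g, mul_inv_cancel_right]

theorem a_mul_x (D : Datum k p G) : D.grp D.a * D.x = (D.χ D.a : k) • (D.x * D.grp D.a) := by
  have h := congrArg (· * D.grp D.a) (D.conj_x D.a)
  simpa [D.c_a, mul_assoc, D.grp_inv_mul] using h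

theorem n_pos [Fact p.Prime] (D : Datum k p G) : 0 < D.n :=
  Nat.mul_pos D.N_pos (pow_pos (Fact.out : p.Prime).pos _)

/-- `g ↦ g ⊗ g`. -/
noncomputable def grpTensor (D : Datum k p G) : G →* D.Alg ⊗[k] D.Alg where
  toFun g := D.grp g ⊗ₜ D.grp g
  map_one' := by simp [Algebra.TensorProduct.one_def]
  map_mul' g h := by simp

theorem grpTensor_apply (D : Datum k p G) (g : G) : D.grpTensor g = D.grp g ⊗ₜ D.grp g := rfl

theorem comul_pow [Fact p.Prime] [CharP k p] (D : Datum k p G) (i : ℕ) :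
    (D.x ⊗ₜ[k] D.grp D.a + 1 ⊗ₜ[k] D.x) ^ (D.N * p ^ i) =
      (D.x ^ (D.N * p ^ i)) ⊗ₜ[k] D.grp (D.a ^ (D.N * p ^ i)) +
        1 ⊗ₜ[k] (D.x ^ (D.N * p ^ i)) := by
  have h : (D.x ⊗ₜ[k] D.grp D.a) * ((1 : D.Alg) ⊗ₜ[k] D.x) =
      (D.χ D.a : k) • (((1 : D.Alg) ⊗ₜ[k] D.x) * (D.x ⊗ₜ[k] D.grp D.a)) := by
    simp [D.a_mul_x]
  rw [add_comm, skew_add_pow_mul p D.N_pos D.primitive h i, add_comm]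
  simp [Algebra.TensorProduct.tmul_pow]

/-- The comultiplication, `Δ(g) = g ⊗ g` and `Δ(x) = x ⊗ a + 1 ⊗ x`. -/
noncomputable def comulHom [Fact p.Prime] [CharP k p] (D : Datum k p G) :
    D.Alg →ₐ[k] D.Alg ⊗[k] D.Alg :=
  D.lift D.grpTensor (D.x ⊗ₜ D.grp D.a + 1 ⊗ₜ D.x)
    (by
      intro g
      simp only [grpTensor_apply, mul_add, add_mul,
        Algebra.TensorProduct.tmul_mul_tmul, D.conj_x, D.conj_a, mul_one, D.grp_mul_inv,
        TensorProduct.add_tmul, TensorProduct.tmul_add, ← TensorProduct.smul_tmul',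
        TensorProduct.tmul_smul, TensorProduct.sub_tmul, TensorProduct.tmul_sub, smul_add,
        smul_sub, Algebra.TensorProduct.one_def]
      abel)
    (by
      rw [n, comul_pow, ← n, D.x_pow]
      have ht : ∀ i, D.α i • ((D.x ^ (D.N * p ^ (i : ℕ))) ⊗ₜ[k] D.grp (D.a ^ D.n)) =
          D.α i • ((D.x ^ (D.N * p ^ (i : ℕ))) ⊗ₜ[k] D.grp (D.a ^ (D.N * p ^ (i : ℕ)))) := by
        intro i
        by_cases h : D.α i = 0
        · simp [h]
        · rw [D.torsion i h, n]
      simp only [comul_pow, grpTensor_apply, TensorProduct.add_tmul,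
        TensorProduct.tmul_add, ← TensorProduct.smul_tmul', TensorProduct.tmul_smul,
        TensorProduct.sub_tmul, TensorProduct.tmul_sub, TensorProduct.sum_tmul,
        TensorProduct.tmul_sum, smul_add, smul_sub, Algebra.TensorProduct.one_def,
        Finset.sum_add_distrib]
      simp only [ht]
      abel)

/-- The counit, `ε(g) = 1` and `ε(x) = 0`. -/
noncomputable def counitHom [Fact p.Prime] (D : Datum k p G) : D.Alg →ₐ[k] k :=
  D.lift 1 0 (by intro g; simp) (by
    have h : ∀ i, D.N * p ^ i ≠ 0 := fun i =>
      (Nat.mul_pos D.N_pos (pow_pos (Fact.out : p.Prime).pos _)).ne'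
    simp [D.n_pos.ne', h])

noncomputable instance [Fact p.Prime] [CharP k p] (D : Datum k p G) : Bialgebra k D.Alg :=
  Bialgebra.ofAlgHom D.comulHom D.counitHom
    (D.algHom_ext (by intro g; simp [comulHom, grpTensor_apply])
      (by
        simp [comulHom, grpTensor_apply, TensorProduct.add_tmul, TensorProduct.tmul_add,
          Algebra.TensorProduct.one_def]
        abel))
    (D.algHom_ext (by intro g; simp [comulHom, counitHom, grpTensor_apply])
      (by simp [comulHom, counitHom]))
    (D.algHom_ext (by intro g; simp [comulHom, counitHom, grpTensor_apply])
      (by simp [comulHom, counitHom]))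

@[simp]
theorem comul_grp [Fact p.Prime] [CharP k p] (D : Datum k p G) (g : G) :
    Coalgebra.comul (R := k) (D.grp g) = D.grp g ⊗ₜ[k] D.grp g :=
  D.lift_grp D.grpTensor _ _ _ g

@[simp]
theorem comul_x [Fact p.Prime] [CharP k p] (D : Datum k p G) :
    Coalgebra.comul (R := k) D.x = D.x ⊗ₜ[k] D.grp D.a + 1 ⊗ₜ[k] D.x :=
  D.lift_x D.grpTensor _ _ _

@[simp]
theorem counit_grp [Fact p.Prime] [CharP k p] (D : Datum k p G) (g : G) :
    Coalgebra.counit (R := k) (D.grp g) = 1 :=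
  D.lift_grp 1 0 _ _ g

@[simp]
theorem counit_x [Fact p.Prime] [CharP k p] (D : Datum k p G) :
    Coalgebra.counit (R := k) D.x = 0 :=
  D.lift_x 1 0 _ _

/-- `g ↦ g⁻¹`, as a homomorphism to the opposite algebra. -/
noncomputable def grpOp (D : Datum k p G) : G →* D.Algᵐᵒᵖ where
  toFun g := MulOpposite.op (D.grp g⁻¹)
  map_one' := by simp
  map_mul' g h := by simp

theorem grpOp_apply (D : Datum k p G) (g : G) : D.grpOp g = MulOpposite.op (D.grp g⁻¹) := rfl

theorem inv_a_mul_x (D : Datum k p G) :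
    D.grp D.a⁻¹ * D.x = (D.χ D.a : k)⁻¹ • (D.x * D.grp D.a⁻¹) := by
  have h := congrArg (fun z => D.grp D.a⁻¹ * z * D.grp D.a⁻¹) D.a_mul_x
  have h2 : D.x * D.grp D.a⁻¹ = (D.χ D.a : k) • (D.grp D.a⁻¹ * D.x) := by
    simpa only [mul_assoc, mul_smul_comm, smul_mul_assoc, D.grp_mul_inv, mul_one,
      ← mul_assoc (D.grp D.a⁻¹) (D.grp D.a), D.grp_inv_mul, one_mul] using h
  rw [h2, smul_smul, inv_mul_cancel₀ (D.χ D.a).ne_zero, one_smul]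

theorem antipode_pow [Fact p.Prime] [CharP k p] (D : Datum k p G) (i : ℕ) :
    (-(D.x * D.grp D.a⁻¹)) ^ (D.N * p ^ i) =
      -(D.x ^ (D.N * p ^ i) * D.grp (D.a⁻¹ ^ (D.N * p ^ i))) := by
  have hq := D.primitive.inv
  have h1 : (-(D.x * D.grp D.a⁻¹)) ^ D.N = -(D.x ^ D.N * D.grp D.a⁻¹ ^ D.N) := by
    rw [neg_pow, skew_mul_pow D.inv_a_mul_x, mul_smul_comm, ← smul_mul_assoc]
    have h2 := neg_one_pow_mul_prod D.N_pos hq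
    have h3 : (∏ j ∈ Finset.range D.N, ((D.χ D.a : k)⁻¹) ^ j) • ((-1 : D.Alg) ^ D.N) = -1 := by
      have h4 : (-1 : D.Alg) ^ D.N = ((-1 : k) ^ D.N) • (1 : D.Alg) := by
        rw [← Algebra.algebraMap_eq_smul_one]; simp
      rw [h4, smul_smul, mul_comm, h2]; simp
    rw [h3, neg_one_mul]
  have hc : Commute (D.x ^ D.N) (D.grp D.a⁻¹ ^ D.N) := by
    have h2 : D.grp D.a⁻¹ * D.x ^ D.N = D.x ^ D.N * D.grp D.a⁻¹ := by
      rw [pow_mul_skew D.inv_a_mul_x, hq.pow_eq_one, one_smul]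
    have h3 : Commute (D.x ^ D.N) (D.grp D.a⁻¹) := h2.symm
    exact h3.pow_right _
  have hneg : ∀ z : D.Alg, (-z) ^ p ^ i = -z ^ p ^ i := by
    intro z
    have h := frobenius_add_pow (k := k) p (Commute.neg_right (Commute.refl z)) i
    rw [add_neg_cancel, zero_pow (pow_pos (Fact.out : p.Prime).pos i).ne'] at h
    exact eq_neg_of_add_eq_zero_right h.symm
  rw [pow_mul, h1, hneg, hc.mul_pow, ← pow_mul, ← pow_mul, map_pow]

/-- The antipode, as a homomorphism to the opposite algebra: `S(g) = g⁻¹`, `S(x) = -x a⁻¹`. -/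
noncomputable def antipodeHom [Fact p.Prime] [CharP k p] (D : Datum k p G) :
    D.Alg →ₐ[k] D.Algᵐᵒᵖ :=
  D.lift D.grpOp (MulOpposite.op (-(D.x * D.grp D.a⁻¹)))
    (by
      intro g
      apply MulOpposite.unop_injective
      have h1 : D.grp g * (D.x * D.grp D.a⁻¹) * D.grp g⁻¹ =
          (D.grp g * D.x * D.grp g⁻¹) * D.grp D.a⁻¹ := by
        have h2 : D.grp D.a⁻¹ * D.grp g⁻¹ = D.grp g⁻¹ * D.grp D.a⁻¹ := by
          rw [← map_mul, ← map_mul, ← mul_inv_rev, ← mul_inv_rev,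
            Subgroup.mem_center_iff.mp D.a_central g]
        simp only [mul_assoc, h2]
      simp only [grpOp_apply, MulOpposite.unop_mul, MulOpposite.unop_op, MulOpposite.unop_add,
        MulOpposite.unop_smul, MulOpposite.unop_sub, MulOpposite.unop_one, inv_inv]
      rw [← mul_assoc, mul_neg, neg_mul, h1, D.conj_x, add_mul, smul_mul_assoc, smul_mul_assoc,
        sub_mul, D.grp_mul_inv, one_mul, smul_neg, neg_add, ← smul_neg (D.c g), neg_sub])
    (by
      apply MulOpposite.unop_injective
      rw [n]
      simp only [MulOpposite.unop_pow, MulOpposite.unop_add, MulOpposite.unop_smul, grpOp_apply,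
        MulOpposite.unop_sub, MulOpposite.unop_op, MulOpposite.unop_one, antipode_pow,
        Finset.unop_sum]
      rw [← n, D.x_pow]
      have ht : ∀ i, D.α i • -(D.x ^ (D.N * p ^ (i : ℕ)) * D.grp (D.a⁻¹ ^ (D.N * p ^ (i : ℕ)))) =
          -((D.α i • D.x ^ (D.N * p ^ (i : ℕ))) * D.grp (D.a⁻¹ ^ D.n)) := by
        intro i
        by_cases h : D.α i = 0
        · simp [h]
        · rw [inv_pow, D.torsion i h, n, inv_pow, smul_neg, smul_mul_assoc]
      simp only [ht]
      rw [Finset.sum_neg_distrib, ← Finset.sum_mul, add_mul, neg_add, smul_mul_assoc, sub_mul,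
        inv_pow, D.grp_mul_inv, one_mul, ← smul_neg, neg_sub])

/-- The antipode, `S(g) = g⁻¹`, `S(x) = -x a⁻¹`, extended antimultiplicatively. -/
noncomputable def antipode [Fact p.Prime] [CharP k p] (D : Datum k p G) : D.Alg →ₗ[k] D.Alg :=
  (MulOpposite.opLinearEquiv k).symm.toLinearMap ∘ₗ D.antipodeHom.toLinearMap

theorem antipode_apply [Fact p.Prime] [CharP k p] (D : Datum k p G) (z : D.Alg) :
    D.antipode z = MulOpposite.unop (D.antipodeHom z) := rfl

@[simp]
theorem antipode_grp [Fact p.Prime] [CharP k p] (D : Datum k p G) (g : G) :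
    D.antipode (D.grp g) = D.grp g⁻¹ := by
  simp [antipode_apply, antipodeHom, grpOp_apply]

@[simp]
theorem antipode_x [Fact p.Prime] [CharP k p] (D : Datum k p G) :
    D.antipode D.x = -(D.x * D.grp D.a⁻¹) := by
  simp [antipode_apply, antipodeHom]

theorem antipode_mul [Fact p.Prime] [CharP k p] (D : Datum k p G) (u v : D.Alg) :
    D.antipode (u * v) = D.antipode v * D.antipode u := by
  simp [antipode_apply]

@[simp]
theorem antipode_one [Fact p.Prime] [CharP k p] (D : Datum k p G) : D.antipode 1 = 1 := by
  simp [antipode_apply]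

theorem antipode_left [Fact p.Prime] [CharP k p] (D : Datum k p G) (z : D.Alg) :
    LinearMap.mul' k D.Alg (D.antipode.rTensor D.Alg (Coalgebra.comul z)) =
      algebraMap k D.Alg (Coalgebra.counit z) := by
  induction z using D.induction with
  | algebraMap s => simp [Algebra.algebraMap_eq_smul_one, Algebra.TensorProduct.one_def]
  | grp g => simp [D.grp_inv_mul]
  | x => simp [mul_assoc, D.grp_inv_mul]
  | add u v hu hv => simp only [map_add, hu, hv]
  | mul u v hu hv =>
    have h1 : ∀ (t : D.Alg ⊗[k] D.Alg) (v₁ v₂ : D.Alg),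
        LinearMap.mul' k D.Alg (D.antipode.rTensor D.Alg (t * v₁ ⊗ₜ v₂)) =
          D.antipode v₁ * LinearMap.mul' k D.Alg (D.antipode.rTensor D.Alg t) * v₂ := by
      intro t v₁ v₂
      induction t with
      | zero => simp
      | tmul a b => simp [antipode_mul, mul_assoc]
      | add a b ha hb => simp only [add_mul, mul_add, map_add, ha, hb]
    have h2 : ∀ s : D.Alg ⊗[k] D.Alg,
        LinearMap.mul' k D.Alg (D.antipode.rTensor D.Alg (Coalgebra.comul u * s)) =
          algebraMap k D.Alg (Coalgebra.counit u) *
            LinearMap.mul' k D.Alg (D.antipode.rTensor D.Alg s) := by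
      intro s
      induction s with
      | zero => simp
      | tmul a b => rw [h1, hu, ← Algebra.commutes]; simp [mul_assoc]
      | add a b ha hb => simp only [mul_add, map_add, ha, hb]
    rw [Bialgebra.comul_mul, h2, hv, ← map_mul, Bialgebra.counit_mul]

theorem antipode_right [Fact p.Prime] [CharP k p] (D : Datum k p G) (z : D.Alg) :
    LinearMap.mul' k D.Alg (D.antipode.lTensor D.Alg (Coalgebra.comul z)) =
      algebraMap k D.Alg (Coalgebra.counit z) := by
  induction z using D.induction with
  | algebraMap s => simp [Algebra.algebraMap_eq_smul_one, Algebra.TensorProduct.one_def]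
  | grp g => simp [D.grp_mul_inv]
  | x => simp
  | add u v hu hv => simp only [map_add, hu, hv]
  | mul u v hu hv =>
    have h1 : ∀ (t : D.Alg ⊗[k] D.Alg) (u₁ u₂ : D.Alg),
        LinearMap.mul' k D.Alg (D.antipode.lTensor D.Alg (u₁ ⊗ₜ u₂ * t)) =
          u₁ * LinearMap.mul' k D.Alg (D.antipode.lTensor D.Alg t) * D.antipode u₂ := by
      intro t u₁ u₂
      induction t with
      | zero => simp
      | tmul a b => simp [antipode_mul, mul_assoc]
      | add a b ha hb => simp only [add_mul, mul_add, map_add, ha, hb]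
    have h2 : ∀ s : D.Alg ⊗[k] D.Alg,
        LinearMap.mul' k D.Alg (D.antipode.lTensor D.Alg (s * Coalgebra.comul v)) =
          LinearMap.mul' k D.Alg (D.antipode.lTensor D.Alg s) *
            algebraMap k D.Alg (Coalgebra.counit v) := by
      intro s
      induction s with
      | zero => simp
      | tmul a b => rw [h1, hv, mul_assoc, Algebra.commutes]; simp [mul_assoc]
      | add a b ha hb => simp only [add_mul, map_add, ha, hb]
    rw [Bialgebra.comul_mul, h2, hu, ← map_mul, Bialgebra.counit_mul]

noncomputable instance [Fact p.Prime] [CharP k p] (D : Datum k p G) : HopfAlgebra k D.Alg where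
  antipode := D.antipode
  mul_antipode_rTensor_comul := LinearMap.ext D.antipode_left
  mul_antipode_lTensor_comul := LinearMap.ext D.antipode_right

/-- The elements `g x^i` with `g ∈ G` and `0 ≤ i ≤ n - 1` form a basis of the algebra. -/
def HasMonomialBasis (D : Datum k p G) : Prop :=
  LinearIndependent k (fun gi : G × Fin D.n => D.grp gi.1 * D.x ^ (gi.2 : ℕ)) ∧
    Submodule.span k (Set.range fun gi : G × Fin D.n => D.grp gi.1 * D.x ^ (gi.2 : ℕ)) = ⊤

end Datum

/-! ## The Hopf algebras `H_R` and `H_F` -/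

/-- A tuple `R = (G, χ, a, α)` of the first type, `α = (α₋₁, α₀, …, α_{r-1})`. Here `N` is the
order of `χ(a)` and `n = N p^r`. -/
structure FirstTuple (k : Type u) [Field k] (p : ℕ) (G : Type w) [Group G] where
  χ : G →* kˣ
  a : G
  r : ℕ
  αneg : k
  α : Fin r → k
  a_central : a ∈ Subgroup.center G
  χ_a : χ a ≠ 1
  αneg_eq_zero : a ^ (orderOf (χ a) * p ^ r) = 1 → αneg = 0
  cond₁ : ∀ i : Fin r, α i ≠ 0 →
    a ^ (orderOf (χ a) * (p ^ r - p ^ (i : ℕ))) = 1 ∧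
      ∀ g, χ g ^ (orderOf (χ a) * (p ^ r - p ^ (i : ℕ))) = 1
  cond₂ : αneg ≠ 0 → ∀ g, χ g ^ (orderOf (χ a) * p ^ r) = 1

/-- The parameters `g x g⁻¹ = χ(g) x`, `x^n = α₋₁ (a^n - 1) + ∑_{i<r} α_i x^(N p^i)`. -/
noncomputable def FirstTuple.toDatum {k : Type u} [Field k] {p : ℕ} [Fact p.Prime] {G : Type w} [Group G]
    [Finite G] (R : FirstTuple k p G) : Datum k p G where
  a := R.a
  a_central := R.a_central
  χ := R.χ
  c := 0
  c_a := rfl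
  N := orderOf (R.χ R.a)
  N_pos := orderOf_pos_iff.mpr (MonoidHom.isOfFinOrder R.χ (isOfFinOrder_of_finite R.a))
  primitive := IsPrimitiveRoot.coe_units_iff.mpr (IsPrimitiveRoot.orderOf (R.χ R.a))
  r := R.r
  αneg := R.αneg
  α := R.α
  torsion := by
    intro i hi
    have h := (R.cond₁ i hi).1
    have hp : p ^ (i : ℕ) ≤ p ^ R.r := Nat.pow_le_pow_right (Fact.out : p.Prime).pos i.2.le
    rw [← Nat.sub_add_cancel hp, mul_add, pow_add, h, one_mul]

/-- The Hopf algebra `H_R`. -/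
abbrev FirstTuple.Hopf {k : Type u} [Field k] {p : ℕ} [Fact p.Prime] {G : Type w} [Group G]
    [Finite G] (R : FirstTuple k p G) : Type (max u w) := R.toDatum.Alg

/-- A tuple `F = (G, χ, c, a, (α₋₁, α₀))` of the second type. -/
structure SecondTuple (k : Type u) [Field k] (p : ℕ) [CharP k p] (G : Type w) [Group G] where
  χ : G →* kˣ
  c : G → k
  a : G
  αneg : k
  α₀ : k
  a_central : a ∈ Subgroup.center G
  χ_a : χ a = 1
  c_mul : ∀ g h, c (h * g) = χ g * c h + c g
  c_a : c a = 0
  α₀_mem : α₀ = 0 ∨ α₀ = 1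
  αneg_eq_zero : α₀ = 0 → αneg = 0
  cond₁ : α₀ = 0 → ∀ g, c g • (MonoidAlgebra.of k G (a ^ p) - 1) = 0
  cond₂ : α₀ = 1 → a ^ p = a ∧
    (∀ g, ∃ m : (ZMod p)ˣ, (χ g : k) = ZMod.castHom (dvd_refl p) k m) ∧
    ∀ g, (αneg * ((χ g : k) - 1) + c g ^ p - c g) • (MonoidAlgebra.of k G a - 1) = 0

/-- The parameters `g x g⁻¹ = χ(g) x + c(g) (a - 1)`, `x^p = α₋₁ (a^p - 1) + α₀ x`, that is,
`N = 1` and `r = 1`. -/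
def SecondTuple.toDatum {k : Type u} [Field k] {p : ℕ} [CharP k p] {G : Type w} [Group G]
    (F : SecondTuple k p G) : Datum k p G where
  a := F.a
  a_central := F.a_central
  χ := F.χ
  c := F.c
  c_a := F.c_a
  N := 1
  N_pos := one_pos
  primitive := by rw [F.χ_a]; exact IsPrimitiveRoot.one
  r := 1
  αneg := F.αneg
  α := fun _ => F.α₀
  torsion := by
    intro i hi
    have h := (F.cond₂ (F.α₀_mem.resolve_left hi)).1
    simp [h]

/-- The Hopf algebra `H_F`. -/
abbrev SecondTuple.Hopf {k : Type u} [Field k] {p : ℕ} [CharP k p] {G : Type w} [Group G]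
    (F : SecondTuple k p G) : Type (max u w) := F.toDatum.Alg

end RankOne

/-!
The group `G` of group-like elements is finite, the coradical of `H` is `kG`, and the proof
determines `H₁`, the commutation and power relations of a skew primitive element, and the linear
independence of the resulting monomials.

*The first term of the filtration.* The quotient `H₁ / kG` is a left Hopf module over `kG`; its
component of degree `g` is cut out by the functionals `coeff g`, and `coinvProj`, which sends `c` to
`∑ g⁻¹ c_g`, projects it onto its coinvariants. This projection factors through `k ⊗_{kG} H₁` and
kills the class of `1`. In rank one its image is therefore the line spanned by the class of
a single nontrivial skew primitive element `x` (`coinvProj_mem_span`). Consequently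
`H₁ = kG + kG x` (`exists_sum_of_comul_mem_wedge`), the skew point `a` is unique, and
`P_{a,1} = k x + k (a - 1)`; the Taft-Wilson theorem is not needed.

*The relations.* Conjugation by `g` maps `P_{a,1}` onto `P_{gag⁻¹,1}`, so `a` is central and
`g x g⁻¹ = χ(g) x + c(g) (a - 1)` (`exists_conj_eq`). For `g = a` this is the dichotomy between
an eigenvector and a unipotent Jordan block, and in the second case conjugating `ord(a)` times gives
`ord(a) (a - 1) = 0`. If `a x a⁻¹ = q x` with `q` of order `N > 1`, then `x^N` is skew primitive for
`a^N`, and fixed by conjugation by `a`, which forces `x^N = α (a^N - 1)`. If `q = 1`, then `x^p`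
is skew primitive for `a^p`, hence lies in `k (a^p - 1)` or in `k x + k (a - 1)`. Adding a multiple
of `a - 1` or rescaling `x` brings this to the required form (`exists_pow_eq`). The conditions on
the parameters come from conjugating the power relation by `g` and comparing coefficients.

*The isomorphism.* As the `q`-integers `(j)_q` with `0 < j < n` do not vanish, comparing
comultiplications shows that the elements `g x^i` with `i < n` are linearly independent
(`linearIndependent_val_mul_pow`). The same monomials span the presented algebra, so the map from it
to `H` is injective; it is surjective because its image contains `H₁`.
-/

namespace RankOne

/-! ### The coradical of a pointed Hopf algebra -/

section Coradical

variable {k : Type u} [Field k] {H : Type v} [Ring H] [HopfAlgebra k H]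

theorem tmul_mem_tensorSub {V W : Submodule k H} {b c : H} (hb : b ∈ V) (hc : c ∈ W) :
    b ⊗ₜ[k] c ∈ tensorSub V W :=
  ⟨⟨b, hb⟩ ⊗ₜ ⟨c, hc⟩, by simp [TensorProduct.mapIncl]⟩

theorem tensorSub_le {V W : Submodule k H} {N : Submodule k (H ⊗[k] H)}
    (h : ∀ b ∈ V, ∀ c ∈ W, b ⊗ₜ[k] c ∈ N) : tensorSub V W ≤ N := by
  rintro _ ⟨t, rfl⟩
  induction t with
  | zero => simp
  | tmul b c => exact h b b.2 c c.2
  | add s t hs ht => rw [map_add]; exact add_mem hs ht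

variable (k H) in
/-- The group algebra of the group-like elements, as a subspace of `H`. -/
def grpSpan : Submodule k H :=
  Submodule.span k (Set.range (GroupLike.val : GroupLike k H → H))

theorem val_mem_grpSpan (g : GroupLike k H) : (g : H) ∈ grpSpan k H :=
  Submodule.subset_span ⟨g, rfl⟩

theorem one_mem_grpSpan : (1 : H) ∈ grpSpan k H :=
  val_mem_grpSpan (1 : GroupLike k H)

theorem mul_mem_grpSpan {b c : H} (hb : b ∈ grpSpan k H) (hc : c ∈ grpSpan k H) :
    b * c ∈ grpSpan k H := by
  have h := Submodule.mul_mem_mul hb hc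
  rw [grpSpan, Submodule.span_mul_span] at h
  refine Submodule.span_mono ?_ h
  rintro _ ⟨_, ⟨g, rfl⟩, _, ⟨g', rfl⟩, rfl⟩
  exact ⟨g * g', rfl⟩

theorem val_mul_inv (g : GroupLike k H) : (g : H) * (g⁻¹ : GroupLike k H) = 1 :=
  congrArg GroupLike.val (mul_inv_cancel g)

theorem inv_mul_val (g : GroupLike k H) : ((g⁻¹ : GroupLike k H) : H) * g = 1 :=
  congrArg GroupLike.val (inv_mul_cancel g)

theorem val_mul (g h : GroupLike k H) : ((g * h : GroupLike k H) : H) = g * h := rfl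

theorem val_one : ((1 : GroupLike k H) : H) = 1 := rfl

theorem comul_val (g : GroupLike k H) :
    Coalgebra.comul (R := k) (g : H) = (g : H) ⊗ₜ[k] (g : H) := g.2.comul_eq_tmul_self

theorem counit_val (g : GroupLike k H) : Coalgebra.counit (R := k) (g : H) = 1 :=
  g.2.counit_eq_one

theorem isSimpleSubcoalgebra_span_val (g : GroupLike k H) :
    IsSimpleSubcoalgebra (Submodule.span k {(g : H)}) := by
  have hg : (g : H) ≠ 0 := g.2.ne_zero
  refine ⟨?_, by simpa using hg, fun E _ hE => ?_⟩
  · intro d hd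
    obtain ⟨s, rfl⟩ := Submodule.mem_span_singleton.mp hd
    rw [map_smul, comul_val]
    exact Submodule.smul_mem _ _ (tmul_mem_tensorSub (Submodule.mem_span_singleton_self _)
      (Submodule.mem_span_singleton_self _))
  · exact (nonzero_span_atom (K := k) (g : H) hg).le_iff.mp hE

/-- A one-dimensional subcoalgebra is spanned by a group-like element. -/
theorem IsSubcoalgebra.le_grpSpan {D : Submodule k H} (hD : IsSubcoalgebra D)
    (h1 : Module.finrank k D = 1) : D ≤ grpSpan k H := by
  obtain ⟨⟨d, hd⟩, hd0, hspan⟩ := finrank_eq_one_iff'.mp h1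
  have hd0' : d ≠ 0 := fun h => hd0 (Subtype.ext h)
  have hle : tensorSub D D ≤ Submodule.span k {d ⊗ₜ[k] d} := by
    refine tensorSub_le fun b hb c hc => ?_
    obtain ⟨s, hs⟩ := hspan ⟨b, hb⟩
    obtain ⟨t, ht⟩ := hspan ⟨c, hc⟩
    obtain rfl : s • d = b := congrArg Subtype.val hs
    obtain rfl : t • d = c := congrArg Subtype.val ht
    rw [TensorProduct.smul_tmul_smul]
    exact Submodule.smul_mem _ _ (Submodule.mem_span_singleton_self _)
  obtain ⟨l, hl⟩ := Submodule.mem_span_singleton.mp (hle (hD d hd))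
  have hl1 : l * Coalgebra.counit (R := k) d = 1 := by
    have h := Coalgebra.rTensor_counit_comul (R := k) d
    rw [← hl, map_smul, LinearMap.rTensor_tmul] at h
    have h2 := congrArg (TensorProduct.lid k H) h
    simp only [map_smul, TensorProduct.lid_tmul, smul_smul, one_smul] at h2
    have h3 : (l * Coalgebra.counit (R := k) d - 1) • d = 0 := by rw [sub_smul, h2]; simp
    exact sub_eq_zero.mp ((smul_eq_zero.mp h3).resolve_right hd0')
  have hl0 : l ≠ 0 := by rintro rfl; simp at hl1
  let g : GroupLike k H := ⟨l • d, ⟨by simpa using hl1, by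
    rw [map_smul, ← hl, TensorProduct.smul_tmul_smul, smul_smul]⟩⟩
  intro b hb
  obtain ⟨s, hs⟩ := hspan ⟨b, hb⟩
  obtain rfl : s • d = b := congrArg Subtype.val hs
  have : d = l⁻¹ • (g : H) := by simp [g, smul_smul, hl0]
  rw [this]
  exact Submodule.smul_mem _ _ (Submodule.smul_mem _ _ (val_mem_grpSpan g))

theorem coradical_eq_grpSpan (hp : IsPointed k H) : coradical k H = grpSpan k H := by
  apply le_antisymm
  · exact sSup_le fun D hD => hD.1.le_grpSpan (hp D hD)
  · refine Submodule.span_le.mpr ?_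
    rintro _ ⟨g, rfl⟩
    exact Submodule.mem_sSup_of_mem (isSimpleSubcoalgebra_span_val g)
      (Submodule.mem_span_singleton_self _)

theorem finite_groupLike [FiniteDimensional k H] : Finite (GroupLike k H) :=
  (linearIndep_groupLikeVal (R := k) (A := H)).finite

end Coradical

/-! ### Coefficient functionals -/

section Coefficients

variable {k : Type u} [Field k] {H : Type v} [Ring H] [HopfAlgebra k H]

open scoped Classical in
theorem exists_coeff : ∃ φ : GroupLike k H → (H →ₗ[k] k),
    ∀ g h : GroupLike k H, φ g (h : H) = if g = h then 1 else 0 := by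
  obtain ⟨π, hπ⟩ := LinearMap.exists_leftInverse_of_injective
    (Finsupp.linearCombination k (GroupLike.val : GroupLike k H → H))
    (LinearMap.ker_eq_bot.mpr (linearIndep_groupLikeVal (R := k) (A := H)))
  refine ⟨fun g => Finsupp.lapply g ∘ₗ π, fun g h => ?_⟩
  have h1 := LinearMap.congr_fun hπ (Finsupp.single h 1)
  simp only [LinearMap.comp_apply, Finsupp.linearCombination_single, one_smul,
    LinearMap.id_apply] at h1
  simp [h1, Finsupp.single_apply, eq_comm]

/-- The functional reading off the coefficient of the group-like element `g`. It is determined on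
the span of the group-like elements, and extended to `H` by a choice. -/
noncomputable def coeff (g : GroupLike k H) : H →ₗ[k] k := Classical.choose exists_coeff g

open scoped Classical in
theorem coeff_val (g h : GroupLike k H) : coeff g (h : H) = if g = h then 1 else 0 :=
  Classical.choose_spec exists_coeff g h

theorem coeff_val_self (g : GroupLike k H) : coeff g (g : H) = 1 := by simp [coeff_val]

theorem coeff_val_of_ne {g h : GroupLike k H} (hgh : g ≠ h) : coeff g (h : H) = 0 := by
  simp [coeff_val, hgh]

/-- The contraction `φ ⊗ id : H ⊗ H → H` of the first factor. -/
noncomputable def contractLeft (φ : H →ₗ[k] k) : H ⊗[k] H →ₗ[k] H :=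
  (TensorProduct.lid k H).toLinearMap ∘ₗ φ.rTensor H

@[simp]
theorem contractLeft_tmul (φ : H →ₗ[k] k) (b c : H) :
    contractLeft φ (b ⊗ₜ[k] c) = φ b • c := by
  simp [contractLeft]

/-- The contraction `id ⊗ φ : H ⊗ H → H` of the second factor. -/
noncomputable def contractRight (φ : H →ₗ[k] k) : H ⊗[k] H →ₗ[k] H :=
  (TensorProduct.rid k H).toLinearMap ∘ₗ φ.lTensor H

@[simp]
theorem contractRight_tmul (φ : H →ₗ[k] k) (b c : H) :
    contractRight φ (b ⊗ₜ[k] c) = φ c • b := by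
  simp [contractRight]

theorem contractLeft_counit_comul (c : H) :
    contractLeft (Coalgebra.counit (R := k)) (Coalgebra.comul (R := k) c) = c := by
  simp [contractLeft]

/-- Coassociativity, with the first factor contracted. -/
theorem comul_contractLeft (φ : H →ₗ[k] k) (c : H) :
    Coalgebra.comul (R := k) (contractLeft φ (Coalgebra.comul (R := k) c)) =
      (contractLeft φ ∘ₗ Coalgebra.comul (R := k)).rTensor H (Coalgebra.comul (R := k) c) := by
  have h1 : ∀ t : H ⊗[k] H, Coalgebra.comul (R := k) (contractLeft φ t) =
      TensorProduct.lid k (H ⊗[k] H) (φ.rTensor (H ⊗[k] H)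
        ((Coalgebra.comul (R := k)).lTensor H t)) := by
    intro t
    induction t with
    | zero => simp
    | tmul b c => simp
    | add s t hs ht => simp only [map_add, hs, ht]
  have h2 : ∀ t : (H ⊗[k] H) ⊗[k] H, TensorProduct.lid k (H ⊗[k] H) (φ.rTensor (H ⊗[k] H)
      (TensorProduct.assoc k H H H t)) = (contractLeft φ).rTensor H t := by
    intro t
    induction t with
    | zero => simp
    | tmul s d =>
      induction s with
      | zero => simp
      | tmul b c => simp [TensorProduct.smul_tmul']
      | add s t hs ht => simp only [TensorProduct.add_tmul, map_add, hs, ht]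
    | add s t hs ht => simp only [map_add, hs, ht]
  rw [h1, ← Coalgebra.coassoc_apply, h2, LinearMap.rTensor_comp_apply]

end Coefficients

/-! ### The first term of the coradical filtration -/

section Filtration

variable {k : Type u} [Field k] {H : Type v} [Ring H] [HopfAlgebra k H]

variable (k H) in
/-- The subspace `H ⊗ kG + kG ⊗ H` of `H ⊗ H`. -/
noncomputable def wedge : Submodule k (H ⊗[k] H) :=
  tensorSub ⊤ (grpSpan k H) ⊔ tensorSub (grpSpan k H) ⊤

theorem mem_coradicalFiltration_one (hp : IsPointed k H) {c : H} :
    c ∈ coradicalFiltration k H 1 ↔ Coalgebra.comul (R := k) c ∈ wedge k H := by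
  simp only [coradicalFiltration, Submodule.mem_comap, coradical_eq_grpSpan hp, wedge]

theorem wedge_le {N : Submodule k (H ⊗[k] H)}
    (h1 : ∀ (b : H) (g : GroupLike k H), b ⊗ₜ[k] (g : H) ∈ N)
    (h2 : ∀ (g : GroupLike k H) (b : H), (g : H) ⊗ₜ[k] b ∈ N) : wedge k H ≤ N := by
  refine sup_le (tensorSub_le fun b _ c hc => ?_) (tensorSub_le fun b hb c _ => ?_)
  · induction hc using Submodule.span_induction with
    | mem c hc => obtain ⟨g, rfl⟩ := hc; exact h1 b g
    | zero => simp
    | add c d _ _ hc hd => rw [TensorProduct.tmul_add]; exact add_mem hc hd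
    | smul s c _ hc => rw [TensorProduct.tmul_smul]; exact N.smul_mem s hc
  · induction hb using Submodule.span_induction with
    | mem c hc => obtain ⟨g, rfl⟩ := hc; exact h2 g c
    | zero => simp
    | add c d _ _ hc hd => rw [TensorProduct.add_tmul]; exact add_mem hc hd
    | smul s c _ hc => rw [← TensorProduct.smul_tmul']; exact N.smul_mem s hc

/-- Two linear maps on `H ⊗ H` agree modulo `N` on `H ⊗ kG + kG ⊗ H` as soon as they map `H ⊗ kG`
into `N` and agree modulo `N` on `kG ⊗ H`. -/
theorem sub_mem_of_mem_wedge {V : Type*} [AddCommGroup V] [Module k V] {N : Submodule k V}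
    {f f' : H ⊗[k] H →ₗ[k] V} (hf : ∀ (b : H) (g : GroupLike k H), f (b ⊗ₜ[k] (g : H)) ∈ N)
    (hf' : ∀ (b : H) (g : GroupLike k H), f' (b ⊗ₜ[k] (g : H)) ∈ N)
    (h : ∀ (g : GroupLike k H) (b : H),
      f ((g : H) ⊗ₜ[k] b) - f' ((g : H) ⊗ₜ[k] b) ∈ N)
    {t : H ⊗[k] H} (ht : t ∈ wedge k H) : f t - f' t ∈ N := by
  have hle : wedge k H ≤ N.comap (f - f') :=
    wedge_le (fun b g => sub_mem (hf b g) (hf' b g)) (fun g b => h g b)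
  exact hle ht

/-- The component of degree `g` for the left coaction of `kG` on `H₁ / kG`, lifted to `H`. -/
noncomputable def component (g : GroupLike k H) : H →ₗ[k] H :=
  contractLeft (coeff g) ∘ₗ Coalgebra.comul (R := k)

theorem component_apply (g : GroupLike k H) (c : H) :
    component g c = contractLeft (coeff g) (Coalgebra.comul (R := k) c) := rfl

theorem sub_sum_component_mem [Fintype (GroupLike k H)] {c : H}
    (hc : Coalgebra.comul (R := k) c ∈ wedge k H) :
    c - ∑ g : GroupLike k H, component g c ∈ grpSpan k H := by
  classical
  have h := sub_mem_of_mem_wedge (N := grpSpan k H)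
    (f := contractLeft (Coalgebra.counit (R := k)))
    (f' := ∑ g : GroupLike k H, contractLeft (coeff g)) ?_ ?_ ?_ hc
  · simpa [component_apply, contractLeft_counit_comul] using h
  · intro b g
    rw [contractLeft_tmul]
    exact Submodule.smul_mem _ _ (val_mem_grpSpan g)
  · intro b g
    rw [LinearMap.sum_apply]
    refine Submodule.sum_mem _ fun i _ => ?_
    rw [contractLeft_tmul]
    exact Submodule.smul_mem _ _ (val_mem_grpSpan g)
  · intro g b
    simp [coeff_val, ite_smul]

theorem comul_component_sub_mem (g : GroupLike k H) {c : H}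
    (hc : Coalgebra.comul (R := k) c ∈ wedge k H) :
    Coalgebra.comul (R := k) (component g c) - (g : H) ⊗ₜ[k] component g c ∈
      tensorSub ⊤ (grpSpan k H) := by
  have h := sub_mem_of_mem_wedge (N := tensorSub ⊤ (grpSpan k H))
    (f := (component g).rTensor H)
    (f' := TensorProduct.mk k H H (g : H) ∘ₗ contractLeft (coeff g)) ?_ ?_ ?_ hc
  · rwa [component_apply, comul_contractLeft]
  · intro b g'
    exact tmul_mem_tensorSub trivial (val_mem_grpSpan g')
  · intro b g'
    simp only [LinearMap.comp_apply, contractLeft_tmul, TensorProduct.mk_apply]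
    exact tmul_mem_tensorSub trivial (Submodule.smul_mem _ _ (val_mem_grpSpan g'))
  · intro g' b
    by_cases hg : g = g'
    · subst hg
      simp [component_apply, coeff_val_self]
    · simp [component_apply, coeff_val_of_ne hg]

theorem comul_component_mem (g : GroupLike k H) {c : H}
    (hc : Coalgebra.comul (R := k) c ∈ wedge k H) :
    Coalgebra.comul (R := k) (component g c) ∈ wedge k H := by
  rw [← sub_add_cancel (Coalgebra.comul (R := k) (component g c))
    ((g : H) ⊗ₜ[k] component g c)]
  exact add_mem (Submodule.mem_sup_left (comul_component_sub_mem g hc))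
    (Submodule.mem_sup_right (tmul_mem_tensorSub (val_mem_grpSpan g) trivial))

theorem contractLeft_mem_grpSpan (φ : H →ₗ[k] k) {t : H ⊗[k] H}
    (ht : t ∈ tensorSub ⊤ (grpSpan k H)) : contractLeft φ t ∈ grpSpan k H := by
  have hle : tensorSub ⊤ (grpSpan k H) ≤ (grpSpan k H).comap (contractLeft φ) := by
    refine tensorSub_le fun b _ c hc => ?_
    rw [Submodule.mem_comap, contractLeft_tmul]
    exact Submodule.smul_mem _ _ hc
  exact hle ht

open scoped Classical in
theorem component_component_sub_mem (g h : GroupLike k H) {c : H}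
    (hc : Coalgebra.comul (R := k) c ∈ wedge k H) :
    component h (component g c) - (if h = g then component g c else 0) ∈ grpSpan k H := by
  have h1 := contractLeft_mem_grpSpan (coeff h) (comul_component_sub_mem g hc)
  rw [map_sub, contractLeft_tmul, coeff_val, ite_smul, one_smul, zero_smul] at h1
  exact h1

theorem component_mul_sub_mem (g h : GroupLike k H) {c : H}
    (hc : Coalgebra.comul (R := k) c ∈ wedge k H) :
    component (h * g) ((h : H) * c) - (h : H) * component g c ∈ grpSpan k H := by
  have key := sub_mem_of_mem_wedge (N := grpSpan k H)
    (f := contractLeft (coeff (h * g)) ∘ₗ LinearMap.mulLeft k ((h : H) ⊗ₜ[k] (h : H)))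
    (f' := LinearMap.mulLeft k (h : H) ∘ₗ contractLeft (coeff g)) ?_ ?_ ?_ hc
  · simpa [component_apply, Bialgebra.comul_mul, comul_val] using key
  · intro b g'
    simp only [LinearMap.comp_apply, LinearMap.mulLeft_apply, Algebra.TensorProduct.tmul_mul_tmul,
      contractLeft_tmul]
    exact Submodule.smul_mem _ _ (val_mem_grpSpan (h * g'))
  · intro b g'
    simp only [LinearMap.comp_apply, LinearMap.mulLeft_apply, contractLeft_tmul, mul_smul_comm]
    exact Submodule.smul_mem _ _ (val_mem_grpSpan (h * g'))
  · intro g' b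
    simp only [LinearMap.comp_apply, LinearMap.mulLeft_apply, Algebra.TensorProduct.tmul_mul_tmul,
      contractLeft_tmul, mul_smul_comm]
    rw [← val_mul]
    by_cases hg : g = g'
    · subst hg
      rw [coeff_val_self, coeff_val_self, sub_self]
      exact zero_mem _
    · have : h * g ≠ h * g' := fun h' => hg (mul_left_cancel h')
      rw [coeff_val_of_ne hg, coeff_val_of_ne this, sub_self]
      exact zero_mem _

/-- The projection of the Hopf module `H₁ / kG` onto its coinvariants, `c ↦ ∑ g⁻¹ c_g` with `c_g`
the component of degree `g`, extended to a linear map `H → H / kG`. -/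
noncomputable def coinvProj [Fintype (GroupLike k H)] : H →ₗ[k] H ⧸ grpSpan k H :=
  (grpSpan k H).mkQ ∘ₗ
    ∑ g : GroupLike k H, LinearMap.mulLeft k ((g⁻¹ : GroupLike k H) : H) ∘ₗ component g

theorem coinvProj_apply [Fintype (GroupLike k H)] (c : H) : coinvProj (k := k) c =
    ∑ g : GroupLike k H,
      (grpSpan k H).mkQ (((g⁻¹ : GroupLike k H) : H) * component g c) := by
  simp [coinvProj]

theorem mkQ_eq_of_sub_mem {V : Type*} [AddCommGroup V] [Module k V] {N : Submodule k V} {b c : V}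
    (h : b - c ∈ N) : N.mkQ b = N.mkQ c :=
  (Submodule.Quotient.eq N).mpr h

theorem mkQ_val_mul_eq {g : GroupLike k H} {b c : H} (h : b - c ∈ grpSpan k H) :
    (grpSpan k H).mkQ ((g : H) * b) = (grpSpan k H).mkQ ((g : H) * c) := by
  apply mkQ_eq_of_sub_mem
  rw [← mul_sub]
  exact mul_mem_grpSpan (val_mem_grpSpan g) h

theorem coinvProj_val_mul [Fintype (GroupLike k H)] (h : GroupLike k H) {c : H}
    (hc : Coalgebra.comul (R := k) c ∈ wedge k H) :
    coinvProj (k := k) ((h : H) * c) = coinvProj (k := k) c := by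
  rw [coinvProj_apply, coinvProj_apply, ← Equiv.sum_comp (Equiv.mulLeft h)]
  refine Finset.sum_congr rfl fun g _ => ?_
  rw [Equiv.coe_mulLeft, mkQ_val_mul_eq (component_mul_sub_mem g h hc), ← mul_assoc, ← val_mul]
  simp

theorem coinvProj_mul [Fintype (GroupLike k H)] {h c : H} (hh : h ∈ grpSpan k H)
    (hc : Coalgebra.comul (R := k) c ∈ wedge k H) :
    coinvProj (k := k) (h * c) = Coalgebra.counit (R := k) h • coinvProj (k := k) c := by
  induction hh using Submodule.span_induction with
  | mem h hh => obtain ⟨g, rfl⟩ := hh; rw [coinvProj_val_mul g hc, counit_val, one_smul]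
  | zero => simp
  | add h h' _ _ ih ih' => rw [add_mul, map_add, map_add, ih, ih', add_smul]
  | smul s h _ ih => rw [smul_mul_assoc, map_smul, map_smul, ih, smul_assoc]

theorem coinvProj_component [Fintype (GroupLike k H)] (g : GroupLike k H) {c : H}
    (hc : Coalgebra.comul (R := k) c ∈ wedge k H) :
    coinvProj (k := k) (component g c) =
      (grpSpan k H).mkQ (((g⁻¹ : GroupLike k H) : H) * component g c) := by
  classical
  rw [coinvProj_apply]
  calc _ = ∑ h : GroupLike k H, (grpSpan k H).mkQ
        (((h⁻¹ : GroupLike k H) : H) * (if h = g then component g c else 0)) :=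
      Finset.sum_congr rfl fun h _ => mkQ_val_mul_eq (component_component_sub_mem g h hc)
    _ = _ := by
      rw [Finset.sum_eq_single g]
      · rw [if_pos rfl]
      · intro h _ hne
        rw [if_neg hne, mul_zero, map_zero]
      · exact fun h => absurd (Finset.mem_univ g) h

theorem coinvProj_one [Fintype (GroupLike k H)] : coinvProj (k := k) (1 : H) = 0 := by
  rw [coinvProj_apply]
  refine Finset.sum_eq_zero fun g _ => ?_
  rw [component_apply, Bialgebra.comul_one, Algebra.TensorProduct.one_def, contractLeft_tmul,
    mul_smul_comm, mul_one, map_smul]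
  rw [Submodule.mkQ_apply, (Submodule.Quotient.mk_eq_zero _).mpr (val_mem_grpSpan _), smul_zero]

theorem coinvProj_of_mem_skewPrimitives [Fintype (GroupLike k H)] {b : GroupLike k H} {y : H}
    (hy : y ∈ skewPrimitives b 1) : coinvProj (k := k) y = (grpSpan k H).mkQ y := by
  classical
  have h : ∀ g : GroupLike k H, component g y - (if g = 1 then y else 0) ∈ grpSpan k H := by
    intro g
    have hy' : Coalgebra.comul (R := k) y = y ⊗ₜ[k] (b : H) + (1 : GroupLike k H).val ⊗ₜ[k] y := hy
    rw [component_apply, hy', map_add, contractLeft_tmul, contractLeft_tmul, coeff_val,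
      ite_smul, one_smul, zero_smul, add_sub_cancel_right]
    exact Submodule.smul_mem _ _ (val_mem_grpSpan b)
  rw [coinvProj_apply]
  calc _ = ∑ g : GroupLike k H, (grpSpan k H).mkQ
        (((g⁻¹ : GroupLike k H) : H) * (if g = 1 then y else 0)) :=
      Finset.sum_congr rfl fun g _ => mkQ_val_mul_eq (h g)
    _ = _ := by
      rw [Finset.sum_eq_single 1]
      · rw [if_pos rfl, inv_one, val_one, one_mul]
      · intro h _ hne
        rw [if_neg hne, mul_zero, map_zero]
      · exact fun h => absurd (Finset.mem_univ _) h

theorem comul_mem_wedge_of_mem_skewPrimitives {b : GroupLike k H} {y : H}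
    (hy : y ∈ skewPrimitives b 1) : Coalgebra.comul (R := k) y ∈ wedge k H := by
  have hy' : Coalgebra.comul (R := k) y = y ⊗ₜ[k] (b : H) + (1 : GroupLike k H).val ⊗ₜ[k] y := hy
  rw [hy']
  exact add_mem (Submodule.mem_sup_left (tmul_mem_tensorSub trivial (val_mem_grpSpan b)))
    (Submodule.mem_sup_right (tmul_mem_tensorSub (val_mem_grpSpan 1) trivial))

theorem comul_mem_wedge_of_mem_grpSpan {c : H} (hc : c ∈ grpSpan k H) :
    Coalgebra.comul (R := k) c ∈ wedge k H := by
  have hle : grpSpan k H ≤ (wedge k H).comap (Coalgebra.comul (R := k)) := by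
    refine Submodule.span_le.mpr ?_
    rintro _ ⟨g, rfl⟩
    show Coalgebra.comul (R := k) (g : H) ∈ wedge k H
    rw [comul_val]
    exact Submodule.mem_sup_left (tmul_mem_tensorSub trivial (val_mem_grpSpan g))
  exact hle hc

/-- In rank one the coinvariants of `H₁ / kG` are spanned by the class of any nontrivial skew
primitive element: `coinvProj` induces a linear map on the two-dimensional space `k ⊗_{kG} H₁`,
and that map kills the class of `1 ⊗ 1`, which is not zero because the counit detects it. -/
theorem coinvProj_mem_span [Fintype (GroupLike k H)] (hp : IsPointed k H) (hr : HasRank k H 1)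
    {b : GroupLike k H} {x : H} (hx : x ∈ skewPrimitives b 1) (hx0 : x ∉ grpSpan k H) {c : H}
    (hc : Coalgebra.comul (R := k) c ∈ wedge k H) :
    coinvProj (k := k) c ∈ Submodule.span k {(grpSpan k H).mkQ x} := by
  let F := coradicalFiltration k H 1
  let M := (k ⊗[k] F) ⧸ balancedRelations k H
  have hM : Module.finrank k M = 2 := hr
  have hfin : FiniteDimensional k M := FiniteDimensional.of_finrank_pos (by omega)
  let Ψ₀ : k ⊗[k] F →ₗ[k] H ⧸ grpSpan k H :=
    (TensorProduct.lid k _).toLinearMap ∘ₗ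
      (coinvProj (k := k) ∘ₗ F.subtype).lTensor k
  let E₀ : k ⊗[k] F →ₗ[k] k :=
    (TensorProduct.lid k _).toLinearMap ∘ₗ
      ((Coalgebra.counit (R := k)) ∘ₗ F.subtype).lTensor k
  have hΨ₀ : ∀ (s : k) (y : F), Ψ₀ (s ⊗ₜ y) = s • coinvProj (k := k) (y : H) := by
    intro s y; simp [Ψ₀]
  have hE₀ : ∀ (s : k) (y : F), E₀ (s ⊗ₜ y) = s * Coalgebra.counit (R := k) (y : H) := by
    intro s y; simp [E₀]
  let Ψ : M →ₗ[k] H ⧸ grpSpan k H := (balancedRelations k H).liftQ Ψ₀ (by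
    refine Submodule.span_le.mpr ?_
    rintro _ ⟨s, h, y, z, hh, hz, rfl⟩
    rw [coradical_eq_grpSpan hp] at hh
    show Ψ₀ _ = 0
    rw [map_sub, hΨ₀, hΨ₀, hz, coinvProj_mul hh ((mem_coradicalFiltration_one hp).mp y.2),
      smul_smul, sub_self])
  let E : M →ₗ[k] k := (balancedRelations k H).liftQ E₀ (by
    refine Submodule.span_le.mpr ?_
    rintro _ ⟨s, h, y, z, hh, hz, rfl⟩
    show E₀ _ = 0
    rw [map_sub, hE₀, hE₀, hz, Bialgebra.counit_mul, mul_assoc, sub_self])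
  have hΨ : ∀ t, Ψ ((balancedRelations k H).mkQ t) = Ψ₀ t := fun _ => rfl
  have hE : ∀ t, E ((balancedRelations k H).mkQ t) = E₀ t := fun _ => rfl
  have hmem : ∀ {d : H}, Coalgebra.comul (R := k) d ∈ wedge k H →
      coinvProj (k := k) d ∈ LinearMap.range Ψ := by
    intro d hd
    refine ⟨(balancedRelations k H).mkQ
      (1 ⊗ₜ ⟨d, (mem_coradicalFiltration_one hp).mpr hd⟩), ?_⟩
    rw [hΨ, hΨ₀, one_smul]
  let e : F := ⟨1, (mem_coradicalFiltration_one hp).mpr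
    (comul_mem_wedge_of_mem_grpSpan one_mem_grpSpan)⟩
  have hker : LinearMap.ker Ψ ≠ ⊥ := by
    intro h
    have h1 : (balancedRelations k H).mkQ (1 ⊗ₜ e) ∈ LinearMap.ker Ψ := by
      rw [LinearMap.mem_ker, hΨ, hΨ₀, coinvProj_one, smul_zero]
    rw [h, Submodule.mem_bot] at h1
    have h2 : E ((balancedRelations k H).mkQ (1 ⊗ₜ e)) = 1 := by
      rw [hE, hE₀, Bialgebra.counit_one, mul_one]
    rw [h1, map_zero] at h2
    exact zero_ne_one h2
  have hrange : Module.finrank k (LinearMap.range Ψ) ≤ 1 := by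
    have h1 := LinearMap.finrank_range_add_finrank_ker Ψ
    have h2 : 0 < Module.finrank k (LinearMap.ker Ψ) := by
      rw [Nat.pos_iff_ne_zero, Ne, Submodule.finrank_eq_zero]
      exact hker
    omega
  have hx1 : (grpSpan k H).mkQ x ≠ 0 := by
    rwa [Submodule.mkQ_apply, Ne, Submodule.Quotient.mk_eq_zero]
  have hx2 : (grpSpan k H).mkQ x ∈ LinearMap.range Ψ := by
    rw [← coinvProj_of_mem_skewPrimitives hx]
    exact hmem (comul_mem_wedge_of_mem_skewPrimitives hx)
  have heq : Submodule.span k {(grpSpan k H).mkQ x} = LinearMap.range Ψ :=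
    Submodule.eq_of_le_of_finrank_le
      ((Submodule.span_singleton_le_iff_mem _ _).mpr hx2)
      (by rwa [finrank_span_singleton hx1])
  rw [heq]
  exact hmem hc

/-- In rank one, `H₁ = kG + kG x` for any nontrivial skew primitive element `x`. -/
theorem exists_sum_of_comul_mem_wedge [Fintype (GroupLike k H)] (hp : IsPointed k H)
    (hr : HasRank k H 1) {b : GroupLike k H} {x : H} (hx : x ∈ skewPrimitives b 1)
    (hx0 : x ∉ grpSpan k H) {c : H} (hc : Coalgebra.comul (R := k) c ∈ wedge k H) :
    ∃ s : GroupLike k H → k, c - ∑ g, s g • ((g : H) * x) ∈ grpSpan k H := by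
  have h : ∀ g : GroupLike k H, ∃ s : k, component g c - s • ((g : H) * x) ∈ grpSpan k H := by
    intro g
    have h1 := coinvProj_mem_span hp hr hx hx0 (comul_component_mem g hc)
    rw [coinvProj_component g hc] at h1
    obtain ⟨s, hs⟩ := Submodule.mem_span_singleton.mp h1
    refine ⟨s, ?_⟩
    rw [← map_smul, Submodule.mkQ_apply, Submodule.mkQ_apply, eq_comm, Submodule.Quotient.eq] at hs
    have h2 := mul_mem_grpSpan (val_mem_grpSpan g) hs
    rwa [mul_sub, ← mul_assoc, val_mul_inv, one_mul, mul_smul_comm] at h2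
  choose s hs using h
  refine ⟨s, ?_⟩
  have h1 := add_mem (sub_sum_component_mem hc)
    (Submodule.sum_mem _ fun g (_ : g ∈ Finset.univ) => hs g)
  rwa [Finset.sum_sub_distrib, sub_add_sub_cancel] at h1

end Filtration

/-! ### Skew primitive elements in rank one -/

section SkewPrimitives

variable {k : Type u} [Field k] {H : Type v} [Ring H] [HopfAlgebra k H]

theorem mem_skewPrimitives_one {b : GroupLike k H} {y : H} : y ∈ skewPrimitives b 1 ↔
    Coalgebra.comul (R := k) y = y ⊗ₜ[k] (b : H) + (1 : H) ⊗ₜ[k] y := Iff.rfl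

theorem add_mem_skewPrimitives {b : GroupLike k H} {y z : H} (hy : y ∈ skewPrimitives b 1)
    (hz : z ∈ skewPrimitives b 1) : y + z ∈ skewPrimitives b 1 := by
  rw [mem_skewPrimitives_one] at *
  rw [map_add, hy, hz, TensorProduct.add_tmul, TensorProduct.tmul_add]
  abel

theorem smul_mem_skewPrimitives {b : GroupLike k H} {y : H} (s : k)
    (hy : y ∈ skewPrimitives b 1) : s • y ∈ skewPrimitives b 1 := by
  rw [mem_skewPrimitives_one] at *
  rw [map_smul, hy, smul_add, TensorProduct.smul_tmul', TensorProduct.tmul_smul]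

theorem val_sub_one_mem_skewPrimitives (b : GroupLike k H) :
    (b : H) - 1 ∈ skewPrimitives b 1 := by
  rw [mem_skewPrimitives_one, map_sub, comul_val, Bialgebra.comul_one,
    Algebra.TensorProduct.one_def, TensorProduct.sub_tmul, TensorProduct.tmul_sub]
  abel

theorem val_sub_one_mem_grpSpan (b : GroupLike k H) : (b : H) - 1 ∈ grpSpan k H :=
  sub_mem (val_mem_grpSpan b) one_mem_grpSpan

theorem val_sub_one_ne_zero {b : GroupLike k H} (hb : b ≠ 1) : (b : H) - 1 ≠ 0 :=
  fun h => hb (GroupLike.val_injective (sub_eq_zero.mp h))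

theorem conj_mem_skewPrimitives (g : GroupLike k H) {b : GroupLike k H} {y : H}
    (hy : y ∈ skewPrimitives b 1) :
    (g : H) * y * (g⁻¹ : GroupLike k H) ∈ skewPrimitives (g * b * g⁻¹) 1 := by
  rw [mem_skewPrimitives_one] at *
  rw [Bialgebra.comul_mul, Bialgebra.comul_mul, hy, comul_val, comul_val, mul_add, add_mul,
    Algebra.TensorProduct.tmul_mul_tmul, Algebra.TensorProduct.tmul_mul_tmul,
    Algebra.TensorProduct.tmul_mul_tmul, Algebra.TensorProduct.tmul_mul_tmul, mul_one,
    val_mul_inv, val_mul, val_mul]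

theorem conj_notMem_grpSpan (g : GroupLike k H) {y : H} (hy : y ∉ grpSpan k H) :
    (g : H) * y * (g⁻¹ : GroupLike k H) ∉ grpSpan k H := by
  intro h
  apply hy
  have h1 := mul_mem_grpSpan (mul_mem_grpSpan (val_mem_grpSpan g⁻¹) h) (val_mem_grpSpan g)
  rwa [mul_assoc, mul_assoc, mul_assoc, inv_mul_val, mul_one, ← mul_assoc, inv_mul_val,
    one_mul] at h1

theorem contractRight_coeff_comul (b : GroupLike k H) {w : H} (hw : w ∈ grpSpan k H) :
    contractRight (coeff b) (Coalgebra.comul (R := k) w) = coeff b w • (b : H) := by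
  induction hw using Submodule.span_induction with
  | mem w hw =>
    obtain ⟨g, rfl⟩ := hw
    rw [comul_val, contractRight_tmul]
    by_cases h : b = g
    · rw [h]
    · rw [coeff_val_of_ne h, zero_smul, zero_smul]
  | zero => simp
  | add w w' _ _ h h' => rw [map_add, map_add, map_add, h, h', add_smul]
  | smul s w _ h => rw [map_smul, map_smul, map_smul, h, smul_assoc]

theorem eq_smul_of_mem_skewPrimitives_of_mem_grpSpan {b : GroupLike k H} {w : H}
    (hw : w ∈ skewPrimitives b 1) (hw0 : w ∈ grpSpan k H) : w = coeff b w • ((b : H) - 1) := by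
  have h := contractRight_coeff_comul b hw0
  rw [mem_skewPrimitives_one.mp hw, map_add, contractRight_tmul, contractRight_tmul,
    coeff_val_self, one_smul] at h
  rw [smul_sub, ← h, add_sub_cancel_right]

variable {a : GroupLike k H} {x : H}

theorem coeffs_eq_of_smul_add_eq (hx0 : x ∉ grpSpan k H) {β β' t t' : k}
    (h : β • x + t • ((a : H) - 1) = β' • x + t' • ((a : H) - 1)) :
    β = β' ∧ (t - t') • ((a : H) - 1) = 0 := by
  have h1 : (β - β') • x = (t' - t) • ((a : H) - 1) := by
    rw [sub_smul, sub_smul, sub_eq_sub_iff_add_eq_add, h]; abel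
  have h2 : β = β' := by
    by_contra hne
    apply hx0
    have h3 : x = (β - β')⁻¹ • (t' - t) • ((a : H) - 1) := by
      rw [← h1, smul_smul, inv_mul_cancel₀ (sub_ne_zero.mpr hne), one_smul]
    rw [h3]
    exact Submodule.smul_mem _ _ (Submodule.smul_mem _ _ (val_sub_one_mem_grpSpan a))
  subst h2
  rw [sub_self, zero_smul] at h1
  refine ⟨rfl, ?_⟩
  rw [← neg_sub, neg_smul, ← h1, neg_zero]

variable [Fintype (GroupLike k H)]

theorem exists_sub_smul_mem_grpSpan (hp : IsPointed k H) (hr : HasRank k H 1)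
    (hx : x ∈ skewPrimitives a 1) (hx0 : x ∉ grpSpan k H) {b : GroupLike k H} {y : H}
    (hy : y ∈ skewPrimitives b 1) : ∃ β : k, y - β • x ∈ grpSpan k H := by
  have h := coinvProj_mem_span hp hr hx hx0 (comul_mem_wedge_of_mem_skewPrimitives hy)
  rw [coinvProj_of_mem_skewPrimitives hy] at h
  obtain ⟨β, hβ⟩ := Submodule.mem_span_singleton.mp h
  refine ⟨β, ?_⟩
  rwa [← map_smul, Submodule.mkQ_apply, Submodule.mkQ_apply, eq_comm, Submodule.Quotient.eq] at hβ

/-- In rank one the skew point is unique. -/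
theorem eq_of_mem_skewPrimitives (hp : IsPointed k H) (hr : HasRank k H 1)
    (hx : x ∈ skewPrimitives a 1) (hx0 : x ∉ grpSpan k H) {b : GroupLike k H} {y : H}
    (hy : y ∈ skewPrimitives b 1) (hy0 : y ∉ grpSpan k H) : b = a := by
  by_contra hne
  obtain ⟨β, hβ⟩ := exists_sub_smul_mem_grpSpan hp hr hx hx0 hy
  apply hy0
  have h := contractRight_coeff_comul b hβ
  rw [map_sub, map_smul, mem_skewPrimitives_one.mp hy, mem_skewPrimitives_one.mp hx] at h
  simp only [map_sub, map_smul, map_add, contractRight_tmul, coeff_val_self, one_smul,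
    coeff_val_of_ne hne, zero_smul, zero_add] at h
  have hy1 : y = (coeff b y - β • coeff b x) • (b : H) - coeff b y • (1 : H) +
      β • coeff b x • (1 : H) := by
    rw [← h]; abel
  rw [hy1]
  exact add_mem (sub_mem (Submodule.smul_mem _ _ (val_mem_grpSpan b))
    (Submodule.smul_mem _ _ one_mem_grpSpan))
    (Submodule.smul_mem _ _ (Submodule.smul_mem _ _ one_mem_grpSpan))

theorem exists_eq_smul_add_smul (hp : IsPointed k H) (hr : HasRank k H 1)
    (hx : x ∈ skewPrimitives a 1) (hx0 : x ∉ grpSpan k H) {y : H}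
    (hy : y ∈ skewPrimitives a 1) : ∃ β t : k, y = β • x + t • ((a : H) - 1) := by
  obtain ⟨β, hβ⟩ := exists_sub_smul_mem_grpSpan hp hr hx hx0 hy
  have h1 : y - β • x ∈ skewPrimitives a 1 := by
    rw [sub_eq_add_neg, ← neg_smul]
    exact add_mem_skewPrimitives hy (smul_mem_skewPrimitives _ hx)
  refine ⟨β, coeff a (y - β • x), ?_⟩
  rw [← eq_smul_of_mem_skewPrimitives_of_mem_grpSpan h1 hβ]
  abel

theorem skewPoint_mem_center (hp : IsPointed k H) (hr : HasRank k H 1)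
    (hx : x ∈ skewPrimitives a 1) (hx0 : x ∉ grpSpan k H) :
    a ∈ Subgroup.center (GroupLike k H) := by
  rw [Subgroup.mem_center_iff]
  intro g
  have h := eq_of_mem_skewPrimitives hp hr hx hx0 (conj_mem_skewPrimitives g hx)
    (conj_notMem_grpSpan g hx0)
  exact mul_inv_eq_iff_eq_mul.mp h

/-- The conjugation action of the group-like elements on a nontrivial skew primitive element. If
`a = 1`, the map `c` is not determined by the conjugation formula, and is chosen to be zero. -/
theorem exists_conj_eq (hp : IsPointed k H) (hr : HasRank k H 1)
    (hx : x ∈ skewPrimitives a 1) (hx0 : x ∉ grpSpan k H) :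
    ∃ (χ : GroupLike k H →* kˣ) (c : GroupLike k H → k),
      (∀ g : GroupLike k H, (g : H) * x * (g⁻¹ : GroupLike k H) =
        (χ g : k) • x + c g • ((a : H) - 1)) ∧
      (∀ g h, c (h * g) = χ g * c h + c g) ∧ (a = 1 → c = 0) := by
  have ha := Subgroup.mem_center_iff.mp (skewPoint_mem_center hp hr hx hx0)
  have hex : ∀ g : GroupLike k H, ∃ β t : k, (g : H) * x * (g⁻¹ : GroupLike k H) =
      β • x + t • ((a : H) - 1) ∧ (a = 1 → t = 0) := by
    intro g
    have h := conj_mem_skewPrimitives g hx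
    rw [mul_inv_eq_iff_eq_mul.mpr (ha g)] at h
    obtain ⟨β, t, ht⟩ := exists_eq_smul_add_smul hp hr hx hx0 h
    by_cases h1 : a = 1
    · refine ⟨β, 0, ?_, fun _ => rfl⟩
      rw [ht, h1, val_one, sub_self, smul_zero, smul_zero]
    · exact ⟨β, t, ht, fun h => absurd h h1⟩
  choose χ₀ c hc hc1 using hex
  have hga : ∀ g : GroupLike k H,
      (g : H) * ((a : H) - 1) * (g⁻¹ : GroupLike k H) = (a : H) - 1 := by
    intro g
    rw [mul_sub, ← val_mul, ha g, val_mul, mul_one, sub_mul, mul_assoc, val_mul_inv, mul_one]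
  have hmul : ∀ g h : GroupLike k H, χ₀ (h * g) • x + c (h * g) • ((a : H) - 1) =
      (χ₀ h * χ₀ g) • x + (χ₀ g * c h + c g) • ((a : H) - 1) := by
    intro g h
    calc _ = ((h * g : GroupLike k H) : H) * x * ((h * g)⁻¹ : GroupLike k H) := (hc _).symm
      _ = (h : H) * ((g : H) * x * (g⁻¹ : GroupLike k H)) * (h⁻¹ : GroupLike k H) := by
        rw [mul_inv_rev, val_mul, val_mul]; simp only [mul_assoc]
      _ = _ := by
        rw [hc g, mul_add, add_mul, mul_smul_comm, mul_smul_comm, smul_mul_assoc, smul_mul_assoc,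
          hc h, hga, smul_add, smul_smul, smul_smul, add_smul, mul_comm (χ₀ g), add_assoc]
  have hone : χ₀ 1 • x + c 1 • ((a : H) - 1) = (1 : k) • x + (0 : k) • ((a : H) - 1) := by
    rw [← hc 1, inv_one, val_one, one_mul, mul_one, one_smul, zero_smul, add_zero]
  let χ : GroupLike k H →* k :=
    { toFun := χ₀
      map_one' := (coeffs_eq_of_smul_add_eq hx0 hone).1
      map_mul' := fun h g => (coeffs_eq_of_smul_add_eq hx0 (hmul g h)).1 }
  refine ⟨χ.toHomUnits, c, hc, fun g h => ?_, fun h => funext fun g => hc1 g h⟩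
  show c (h * g) = χ₀ g * c h + c g
  by_cases h1 : a = 1
  · rw [hc1 _ h1, hc1 _ h1, hc1 _ h1, mul_zero, add_zero]
  · have h2 := (coeffs_eq_of_smul_add_eq hx0 (hmul g h)).2
    exact sub_eq_zero.mp ((smul_eq_zero.mp h2).resolve_right (val_sub_one_ne_zero h1))

end SkewPrimitives

/-! ### Linear independence of the monomials -/

section Monomials

variable {k : Type u} [Field k] {H : Type v} [Ring H] [HopfAlgebra k H]

variable (k) in
/-- The span of the elements `g x^i` with `g` group-like and `i < m`. -/
def monomialSpan (x : H) (m : ℕ) : Submodule k H :=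
  Submodule.span k {y | ∃ (g : GroupLike k H) (i : ℕ), i < m ∧ y = (g : H) * x ^ i}

theorem val_mul_pow_mem_monomialSpan (x : H) {m i : ℕ} (hi : i < m) (g : GroupLike k H) :
    (g : H) * x ^ i ∈ monomialSpan k x m :=
  Submodule.subset_span ⟨g, i, hi, rfl⟩

theorem comul_val_mul_pow {a : GroupLike k H} {x : H} (hx : x ∈ skewPrimitives a 1) {q : k}
    (hax : (a : H) * x = q • (x * a)) (g : GroupLike k H) (m : ℕ) :
    Coalgebra.comul (R := k) ((g : H) * x ^ m) = ∑ ij ∈ Finset.HasAntidiagonal.antidiagonal m,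
      gaussBinom q ij.1 ij.2 •
        (((g : H) * x ^ ij.2) ⊗ₜ[k] ((g : H) * x ^ ij.1 * (a : H) ^ ij.2)) := by
  have h : (x ⊗ₜ[k] (a : H)) * ((1 : H) ⊗ₜ[k] x) =
      q • (((1 : H) ⊗ₜ[k] x) * (x ⊗ₜ[k] (a : H))) := by
    simp [hax]
  rw [Bialgebra.comul_mul, Bialgebra.comul_pow, mem_skewPrimitives_one.mp hx, add_comm,
    skew_binomial h, Finset.mul_sum, comul_val]
  refine Finset.sum_congr rfl fun ij _ => ?_
  simp [Algebra.TensorProduct.tmul_pow, mul_assoc]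

/-- The functional `f ⊗ e` on `H ⊗ H`. -/
noncomputable def pairing (f e : H →ₗ[k] k) : H ⊗[k] H →ₗ[k] k :=
  LinearMap.mul' k k ∘ₗ TensorProduct.map f e

theorem pairing_comul_val_mul_pow {a : GroupLike k H} {x : H} (hx : x ∈ skewPrimitives a 1) {q : k}
    (hax : (a : H) * x = q • (x * a)) (f e : H →ₗ[k] k) (g : GroupLike k H) (m : ℕ) :
    pairing f e (Coalgebra.comul (R := k) ((g : H) * x ^ m)) =
      ∑ ij ∈ Finset.HasAntidiagonal.antidiagonal m,
        gaussBinom q ij.1 ij.2 * (f ((g : H) * x ^ ij.2) *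
          e ((g : H) * x ^ ij.1 * (a : H) ^ ij.2)) := by
  rw [comul_val_mul_pow hx hax, map_sum]
  simp [pairing]

theorem gaussBinom_one (q : k) (m : ℕ) : gaussBinom q 1 m = gaussInt q (m + 1) := by
  induction m with
  | zero => simp [gaussBinom, gaussInt]
  | succ m ih =>
    rw [gaussBinom, gaussBinom_zero_left, ih, add_comm (m + 1) 1, gaussInt_add q 1 (m + 1)]
    congr 1
    exact (by simp [gaussInt] : (1 : k) = gaussInt q 1)

/-- If `x^m` were a combination of lower monomials, then the component of its comultiplication in
degree `(m - 1, 1)`, which is `(m)_q x^(m-1) ⊗ x a^(m-1)`, would vanish. -/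
theorem pow_notMem_monomialSpan {a : GroupLike k H} {x : H} (hx : x ∈ skewPrimitives a 1)
    (hx0 : x ∉ grpSpan k H) {q : k} (hax : (a : H) * x = q • (x * a)) {n : ℕ}
    (hn : ∀ j, 0 < j → j < n → gaussInt q j ≠ 0) {m : ℕ} (hm : m < n) :
    x ^ m ∉ monomialSpan k x m := by
  induction m with
  | zero =>
    have h : monomialSpan k x 0 = ⊥ := by simp [monomialSpan]
    rw [h, pow_zero, Submodule.mem_bot]
    exact (val_one (k := k) (H := H)) ▸ (1 : GroupLike k H).2.ne_zero
  | succ m ih =>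
    rcases Nat.eq_zero_or_pos m with rfl | hm0
    · intro h
      apply hx0
      rw [zero_add, pow_one] at h
      refine Submodule.span_le.mpr ?_ h
      rintro _ ⟨g, i, hi, rfl⟩
      obtain rfl : i = 0 := by omega
      rw [pow_zero, mul_one]
      exact val_mem_grpSpan g
    -- `f ⊗ e` isolates the component of degree `(m, 1)`.
    intro hmem
    obtain ⟨f, hf, hf0⟩ := Submodule.exists_le_ker_of_notMem (ih (by omega))
    have hxa : x * (a : H) ^ m ∉ grpSpan k H := by
      intro h
      apply hx0
      have h1 := mul_mem_grpSpan h (val_mem_grpSpan (a ^ m)⁻¹)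
      rwa [mul_assoc, show (a : H) ^ m = ((a ^ m : GroupLike k H) : H) from rfl, val_mul_inv,
        mul_one] at h1
    obtain ⟨e, he, he0⟩ := Submodule.exists_le_ker_of_notMem hxa
    have hf' : ∀ (g : GroupLike k H) (i : ℕ), i < m → f ((g : H) * x ^ i) = 0 :=
      fun g i hi => hf0 (val_mul_pow_mem_monomialSpan x hi g)
    have he' : ∀ (g : GroupLike k H) (i : ℕ), e ((g : H) * x ^ 0 * (a : H) ^ i) = 0 := by
      intro g i
      rw [pow_zero, mul_one]
      exact he0 (val_mem_grpSpan (g * a ^ i))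
    have hle : monomialSpan k x (m + 1) ≤
        LinearMap.ker (pairing f e ∘ₗ Coalgebra.comul (R := k)) := by
      refine Submodule.span_le.mpr ?_
      rintro _ ⟨g, i, hi, rfl⟩
      show pairing f e (Coalgebra.comul (R := k) ((g : H) * x ^ i)) = 0
      rw [pairing_comul_val_mul_pow hx hax]
      refine Finset.sum_eq_zero fun ij hij => ?_
      have hij' := Finset.HasAntidiagonal.mem_antidiagonal.mp hij
      by_cases h2 : ij.2 < m
      · rw [hf' _ _ h2, zero_mul, mul_zero]
      · obtain h1 : ij.1 = 0 := by omega
        rw [h1, he', mul_zero, mul_zero]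
    have h0 : pairing f e
        (Coalgebra.comul (R := k) ((1 : GroupLike k H).val * x ^ (m + 1))) = 0 := by
      rw [val_one, one_mul]
      exact hle hmem
    rw [pairing_comul_val_mul_pow hx hax, Finset.sum_eq_single (1, m)] at h0
    · simp only [val_one, one_mul, pow_one, gaussBinom_one] at h0
      exact mul_ne_zero (hn (m + 1) (by omega) hm) (mul_ne_zero hf he) h0
    · rintro ⟨i, j⟩ hij hne
      have hij' := Finset.HasAntidiagonal.mem_antidiagonal.mp hij
      simp only at hij' ⊢
      rcases lt_or_ge j m with h | h
      · rw [hf' _ _ h, zero_mul, mul_zero]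
      · obtain h1 : i = 0 := by
          by_contra hi
          exact hne (Prod.ext (by simp only; omega) (by simp only; omega))
        rw [h1, he', mul_zero, mul_zero]
    · intro h
      exact absurd (Finset.HasAntidiagonal.mem_antidiagonal.mpr (by simp only; omega)) h

/-- The monomials are triangular with respect to the functionals `(f(g⁻¹ ·) ⊗ coeff (g a^m)) ∘ Δ`,
where `f` vanishes on the monomials of degree less than `m` and not on `x^m`. -/
theorem linearIndependent_val_mul_pow [Finite (GroupLike k H)] {a : GroupLike k H} {x : H}
    (hx : x ∈ skewPrimitives a 1) (hx0 : x ∉ grpSpan k H) {q : k}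
    (hax : (a : H) * x = q • (x * a)) {n : ℕ} (hn : ∀ j, 0 < j → j < n → gaussInt q j ≠ 0) :
    LinearIndependent k (fun gi : GroupLike k H × Fin n => (gi.1 : H) * x ^ (gi.2 : ℕ)) := by
  classical
  have := Fintype.ofFinite (GroupLike k H)
  rw [Fintype.linearIndependent_iff]
  intro c hc
  -- Descending induction on the exponent.
  have key : ∀ d : ℕ, ∀ (g : GroupLike k H) (i : Fin n), n ≤ i + d → c (g, i) = 0 := by
    intro d
    induction d with
    | zero => intro g i hi; have := i.2; omega
    | succ d ih =>
      intro g m hm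
      by_cases hmd : n ≤ m + d
      · exact ih g m hmd
      obtain ⟨f, hf, hf0⟩ := Submodule.exists_le_ker_of_notMem
        (pow_notMem_monomialSpan hx hx0 hax hn m.2)
      let Λ : H →ₗ[k] k := pairing (f ∘ₗ LinearMap.mulLeft k ((g⁻¹ : GroupLike k H) : H))
        (coeff (g * a ^ (m : ℕ))) ∘ₗ Coalgebra.comul (R := k)
      have hf' : ∀ (g' : GroupLike k H) (i : ℕ), i < m →
          f (((g⁻¹ : GroupLike k H) : H) * ((g' : H) * x ^ i)) = 0 := by
        intro g' i hi
        rw [← mul_assoc, ← val_mul]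
        exact hf0 (val_mul_pow_mem_monomialSpan x hi _)
      have hΛ : ∀ (g' : GroupLike k H) (i : ℕ), Λ ((g' : H) * x ^ i) =
          ∑ ij ∈ Finset.HasAntidiagonal.antidiagonal i, gaussBinom q ij.1 ij.2 *
            (f (((g⁻¹ : GroupLike k H) : H) * ((g' : H) * x ^ ij.2)) *
              coeff (g * a ^ (m : ℕ)) ((g' : H) * x ^ ij.1 * (a : H) ^ ij.2)) :=
        fun g' i => pairing_comul_val_mul_pow hx hax _ _ g' i
      have hΛlt : ∀ (g' : GroupLike k H) (i : ℕ), i < m → Λ ((g' : H) * x ^ i) = 0 := by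
        intro g' i hi
        rw [hΛ]
        refine Finset.sum_eq_zero fun ij hij => ?_
        have hij' := Finset.HasAntidiagonal.mem_antidiagonal.mp hij
        rw [hf' g' ij.2 (by omega), zero_mul, mul_zero]
      have hΛm : ∀ g' : GroupLike k H,
          Λ ((g' : H) * x ^ (m : ℕ)) = if g = g' then f (x ^ (m : ℕ)) else 0 := by
        intro g'
        rw [hΛ, Finset.sum_eq_single (0, (m : ℕ))]
        · have h1 : (g' : H) * x ^ 0 * (a : H) ^ (m : ℕ) =
              ((g' * a ^ (m : ℕ) : GroupLike k H) : H) := by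
            rw [pow_zero, mul_one]; rfl
          simp only [h1, gaussBinom_zero_left, one_mul]
          split_ifs with h
          · rw [← h, coeff_val_self, mul_one, ← mul_assoc, inv_mul_val, one_mul]
          · rw [coeff_val_of_ne (fun h' => h (mul_right_cancel h')), mul_zero]
        · rintro ⟨i, j⟩ hij hne
          have hij' := Finset.HasAntidiagonal.mem_antidiagonal.mp hij
          simp only at hij' ⊢
          have hj : j < m := by
            by_contra hj
            exact hne (Prod.ext (by simp only; omega) (by simp only; omega))
          rw [hf' _ _ hj, zero_mul, mul_zero]
        · intro h
          exact absurd (Finset.HasAntidiagonal.mem_antidiagonal.mpr (by simp)) h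
      have h0 := congrArg Λ hc
      rw [map_sum, map_zero, Finset.sum_eq_single (g, m)] at h0
      · rw [map_smul, hΛm, if_pos rfl, smul_eq_mul] at h0
        exact (mul_eq_zero.mp h0).resolve_right hf
      · rintro ⟨g', i⟩ _ hne
        rw [map_smul]
        rcases lt_trichotomy i m with h | h | h
        · rw [hΛlt g' i h, smul_zero]
        · subst h
          rw [hΛm, if_neg (fun h => hne (by rw [h])), smul_zero]
        · rw [ih g' i (by have : (m : ℕ) < i := h; omega), zero_smul]
      · exact fun h => absurd (Finset.mem_univ _) h
  exact fun gi => key n gi.1 gi.2 (by omega)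

end Monomials

/-! ### The monomials span the presented algebra -/

namespace Datum

variable {k : Type u} [Field k] {p : ℕ} {G : Type w} [Group G]

theorem x_mul_grp (D : Datum k p G) (g : G) : D.x * D.grp g =
    (D.χ g⁻¹ : k) • (D.grp g * D.x) + D.c g⁻¹ • (D.grp (g * D.a) - D.grp g) := by
  have h := congrArg (D.grp g * ·) (D.conj_x g⁻¹)
  simp only [inv_inv, mul_add, mul_smul_comm, mul_sub, mul_one] at h
  rwa [← mul_assoc, ← mul_assoc, D.grp_mul_inv, one_mul, ← map_mul] at h

theorem span_monomials [Fact p.Prime] (D : Datum k p G) :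
    Submodule.span k (Set.range fun gi : G × Fin D.n => D.grp gi.1 * D.x ^ (gi.2 : ℕ)) = ⊤ := by
  set V := Submodule.span k (Set.range fun gi : G × Fin D.n => D.grp gi.1 * D.x ^ (gi.2 : ℕ))
  have hlt : ∀ (g : G) (i : ℕ), i < D.n → D.grp g * D.x ^ i ∈ V :=
    fun g i hi => Submodule.subset_span ⟨(g, ⟨i, hi⟩), rfl⟩
  have hgrp : ∀ g : G, D.grp g ∈ V := by
    intro g
    have h := hlt g 0 D.n_pos
    rwa [pow_zero, mul_one] at h
  have hle : ∀ (g : G) (i : ℕ), i ≤ D.n → D.grp g * D.x ^ i ∈ V := by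
    intro g i hi
    rcases hi.lt_or_eq with h | rfl
    · exact hlt g i h
    rw [D.x_pow, mul_add, mul_smul_comm, mul_sub, mul_one, ← map_mul, Finset.mul_sum]
    refine add_mem (V.smul_mem _ (sub_mem (hgrp _) (hgrp _))) (Submodule.sum_mem _ fun i _ => ?_)
    rw [mul_smul_comm]
    refine V.smul_mem _ (hlt g _ ?_)
    exact Nat.mul_lt_mul_of_pos_left (Nat.pow_lt_pow_right (Fact.out : p.Prime).one_lt i.2) D.N_pos
  -- The span is a left ideal containing `1`.
  have hmul : ∀ z v : D.Alg, v ∈ V → z * v ∈ V := by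
    intro z
    induction z using D.induction with
    | algebraMap s =>
      intro v hv
      rw [← Algebra.smul_def]
      exact V.smul_mem s hv
    | grp g =>
      intro v hv
      induction hv using Submodule.span_induction with
      | mem v hv =>
        obtain ⟨⟨g', i⟩, rfl⟩ := hv
        simp only
        rw [← mul_assoc, ← map_mul]
        exact hlt _ _ i.2
      | zero => simp
      | add v v' _ _ h h' => rw [mul_add]; exact add_mem h h'
      | smul s v _ h => rw [mul_smul_comm]; exact V.smul_mem s h
    | x =>
      intro v hv
      induction hv using Submodule.span_induction with
      | mem v hv =>
        obtain ⟨⟨g, i⟩, rfl⟩ := hv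
        simp only
        rw [← mul_assoc, D.x_mul_grp, add_mul, smul_mul_assoc, smul_mul_assoc, sub_mul, mul_assoc,
          ← pow_succ']
        exact add_mem (V.smul_mem _ (hle _ _ i.2))
          (V.smul_mem _ (sub_mem (hlt _ _ i.2) (hlt _ _ i.2)))
      | zero => simp
      | add v v' _ _ h h' => rw [mul_add]; exact add_mem h h'
      | smul s v _ h => rw [mul_smul_comm]; exact V.smul_mem s h
    | add z z' h h' => intro v hv; rw [add_mul]; exact add_mem (h v hv) (h' v hv)
    | mul z z' h h' => intro v hv; rw [mul_assoc]; exact h _ (h' v hv)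
  rw [eq_top_iff]
  intro z _
  have h := hmul z 1 (by rw [← map_one D.grp]; exact hgrp 1)
  rwa [mul_one] at h

end Datum

/-! ### Recognition of the presented Hopf algebras -/

section Recognition

variable {k : Type u} [Field k] {H : Type v} [Ring H] [HopfAlgebra k H]

/-- If a nontrivial skew primitive element `x` of a pointed Hopf algebra of rank one satisfies the
relations of a datum on the group of group-like elements, then the resulting map from the presented
algebra is an isomorphism: its image contains `H₁ = kG + kG x`, and it maps the spanning
monomials to linearly independent elements. -/
theorem Datum.hasMonomialBasis_and_nonempty_bialgEquiv {p : ℕ} [Fact p.Prime] [CharP k p]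
    [Finite (GroupLike k H)] (hp : IsPointed k H) (hr : HasRank k H 1)
    (hgen : Algebra.adjoin k (coradicalFiltration k H 1 : Set H) = ⊤)
    (D : Datum k p (GroupLike k H)) {x : H} (hx : x ∈ skewPrimitives D.a 1)
    (hx0 : x ∉ grpSpan k H)
    (hconj : ∀ g : GroupLike k H, (g : H) * x * (g⁻¹ : GroupLike k H) =
      (D.χ g : k) • x + D.c g • ((D.a : H) - 1))
    (hpow : x ^ D.n = D.αneg • (((D.a ^ D.n : GroupLike k H) : H) - 1) +
      ∑ i, D.α i • x ^ (D.N * p ^ (i : ℕ)))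
    (hn : ∀ j, 0 < j → j < D.n → gaussInt (D.χ D.a : k) j ≠ 0) :
    D.HasMonomialBasis ∧ Nonempty (H ≃ₐc[k] D.Alg) := by
  have := Fintype.ofFinite (GroupLike k H)
  let φ : D.Alg →ₐ[k] H := D.lift (GroupLike.valMonoidHom k H) x hconj hpow
  have hφg : ∀ g, φ (D.grp g) = (g : H) := fun g => D.lift_grp _ _ hconj hpow g
  have hφx : φ D.x = x := D.lift_x _ _ hconj hpow
  have hax : (D.a : H) * x = (D.χ D.a : k) • (x * D.a) := by
    have h := congrArg (· * (D.a : H)) (hconj D.a)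
    simp only [D.c_a, zero_smul, add_zero, smul_mul_assoc] at h
    rwa [mul_assoc, inv_mul_val, mul_one] at h
  have hind := linearIndependent_val_mul_pow hx hx0 hax hn
  have hcomp : (fun gi : GroupLike k H × Fin D.n => (gi.1 : H) * x ^ (gi.2 : ℕ)) =
      φ.toLinearMap ∘ fun gi : GroupLike k H × Fin D.n => D.grp gi.1 * D.x ^ (gi.2 : ℕ) := by
    funext gi
    simp [hφg, hφx]
  have hind' : LinearIndependent k
      (fun gi : GroupLike k H × Fin D.n => D.grp gi.1 * D.x ^ (gi.2 : ℕ)) := by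
    rw [hcomp] at hind
    exact hind.of_comp _
  refine ⟨⟨hind', D.span_monomials⟩, ?_⟩
  have hinj : Function.Injective φ := by
    rw [hcomp] at hind
    exact LinearMap.injective_of_linearIndependent D.span_monomials hind
  have hsurj : Function.Surjective φ := by
    have hle : Algebra.adjoin k (coradicalFiltration k H 1 : Set H) ≤ φ.range := by
      refine Algebra.adjoin_le fun c hc => ?_
      obtain ⟨s, hs⟩ := exists_sum_of_comul_mem_wedge hp hr hx hx0
        ((mem_coradicalFiltration_one hp).mp hc)
      have hspan : grpSpan k H ≤ Subalgebra.toSubmodule φ.range := by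
        refine Submodule.span_le.mpr ?_
        rintro _ ⟨g, rfl⟩
        exact ⟨D.grp g, hφg g⟩
      rw [← sub_add_cancel c (∑ g, s g • ((g : H) * x))]
      refine add_mem (hspan hs) (sum_mem fun g _ => φ.range.smul_mem (mul_mem ?_ ?_) _)
      · exact ⟨D.grp g, hφg g⟩
      · exact ⟨D.x, hφx⟩
    rw [hgen, top_le_iff] at hle
    exact (AlgHom.range_eq_top φ).mp hle
  let Φ : D.Alg →ₐc[k] H := BialgHom.ofAlgHom φ
    (D.algHom_ext (by intro g; simp [hφg]) (by
      have h := congrArg (contractLeft (Coalgebra.counit (R := k))) (mem_skewPrimitives_one.mp hx)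
      rw [contractLeft_counit_comul, map_add, contractLeft_tmul, contractLeft_tmul,
        Bialgebra.counit_one, one_smul, right_eq_add] at h
      have h0 : Coalgebra.counit (R := k) x = 0 :=
        (smul_eq_zero.mp h).resolve_right D.a.2.ne_zero
      simp [hφx, h0]))
    (D.algHom_ext (by intro g; simp [hφg])
      (by simp [hφx, hφg, mem_skewPrimitives_one.mp hx]))
  exact ⟨(BialgEquiv.ofBijective Φ ⟨hinj, hsurj⟩).symm⟩

end Recognition

/-! ### Powers of a skew primitive element -/

section Powers

variable {k : Type u} [Field k] {H : Type v} [Ring H] [HopfAlgebra k H]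

theorem conj_pow (g : GroupLike k H) (y : H) (n : ℕ) :
    ((g : H) * y * (g⁻¹ : GroupLike k H)) ^ n = (g : H) * y ^ n * (g⁻¹ : GroupLike k H) := by
  induction n with
  | zero => simp only [pow_zero, mul_one, val_mul_inv]
  | succ n ih =>
    rw [pow_succ, ih, pow_succ]
    simp only [mul_assoc]
    rw [← mul_assoc ((g⁻¹ : GroupLike k H) : H) (g : H), inv_mul_val, one_mul]

theorem conj_central {a : GroupLike k H} (ha : a ∈ Subgroup.center (GroupLike k H))
    (g : GroupLike k H) : (g : H) * a * (g⁻¹ : GroupLike k H) = a := by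
  rw [← val_mul, Subgroup.mem_center_iff.mp ha g, val_mul, mul_assoc, val_mul_inv, mul_one]

theorem conj_central_sub_one {a : GroupLike k H} (ha : a ∈ Subgroup.center (GroupLike k H))
    (g : GroupLike k H) : (g : H) * ((a : H) - 1) * (g⁻¹ : GroupLike k H) = (a : H) - 1 := by
  rw [mul_sub, sub_mul, conj_central ha, mul_one, val_mul_inv]

theorem mul_eq_smul_of_conj_eq_smul {a : GroupLike k H} {x : H} {q : k}
    (h : (a : H) * x * (a⁻¹ : GroupLike k H) = q • x) : (a : H) * x = q • (x * a) := by
  have h1 := congrArg (· * (a : H)) h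
  simpa only [mul_assoc, inv_mul_val, mul_one, smul_mul_assoc] using h1

theorem pow_mem_skewPrimitives (p : ℕ) [Fact p.Prime] [CharP k p] {a : GroupLike k H} {x : H}
    (hx : x ∈ skewPrimitives a 1) {q : k} (hax : (a : H) * x = q • (x * a)) {N : ℕ} (hN : 0 < N)
    (hq : IsPrimitiveRoot q N) (r : ℕ) :
    x ^ (N * p ^ r) ∈ skewPrimitives (a ^ (N * p ^ r)) 1 := by
  have h : (x ⊗ₜ[k] (a : H)) * ((1 : H) ⊗ₜ[k] x) =
      q • (((1 : H) ⊗ₜ[k] x) * (x ⊗ₜ[k] (a : H))) := by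
    simp [hax]
  rw [mem_skewPrimitives_one, Bialgebra.comul_pow, mem_skewPrimitives_one.mp hx, add_comm,
    skew_add_pow_mul p hN hq h, add_comm, Algebra.TensorProduct.tmul_pow,
    Algebra.TensorProduct.tmul_pow, one_pow]
  rfl

theorem smul_add_smul_sub_one_pow (p : ℕ) [Fact p.Prime] [CharP k p] {a : GroupLike k H} {x : H}
    (h : Commute x (a : H)) (β t : k) : (β • x + t • ((a : H) - 1)) ^ p =
      β ^ p • x ^ p + t ^ p • (((a ^ p : GroupLike k H) : H) - 1) := by
  have h1 : Commute (β • x) (t • ((a : H) - 1)) :=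
    ((h.sub_right (Commute.one_right x)).smul_left β).smul_right t
  have h2 : ((a : H) - 1) ^ p = (a : H) ^ p - 1 := by
    have h3 := frobenius_add_pow (k := k) p (Commute.one_right ((a : H) - 1)) 1
    rw [sub_add_cancel, pow_one, one_pow] at h3
    rw [h3, add_sub_cancel_right]
  have h3 := frobenius_add_pow (k := k) p h1 1
  rw [pow_one] at h3
  rw [h3, smul_pow, smul_pow, h2]
  rfl

/-- If `x` commutes with `a` up to `a - 1`, then conjugating `ord(a)` times adds
`ord(a) (a - 1)` to `x`. -/
theorem dvd_orderOf_of_conj_eq_add (p : ℕ) [CharP k p] {a : GroupLike k H} (ha : a ≠ 1) {x : H}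
    (h : (a : H) * x * (a⁻¹ : GroupLike k H) = x + ((a : H) - 1)) : p ∣ orderOf a := by
  have h1 : (a : H) * x = (x + ((a : H) - 1)) * a := by
    rw [← h, mul_assoc, inv_mul_val, mul_one]
  have h2 : ∀ m : ℕ, (a : H) ^ m * x = (x + (m : k) • ((a : H) - 1)) * (a : H) ^ m := by
    intro m
    induction m with
    | zero => simp
    | succ m ih =>
      have hc : (a : H) * ((a : H) - 1) = ((a : H) - 1) * a := by rw [mul_sub, sub_mul]; simp
      rw [pow_succ', mul_assoc, ih, ← mul_assoc, mul_add, h1, mul_smul_comm, hc,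
        ← smul_mul_assoc, ← add_mul, mul_assoc, Nat.cast_succ, add_smul, one_smul,
        add_assoc, add_comm ((a : H) - 1)]
  have h3 := h2 (orderOf a)
  have h4 : (a : H) ^ orderOf a = 1 := congrArg GroupLike.val (pow_orderOf_eq_one a)
  rw [h4, one_mul, mul_one, left_eq_add] at h3
  exact (CharP.cast_eq_zero_iff k p _).mp
    ((smul_eq_zero.mp h3).resolve_right (val_sub_one_ne_zero ha))

end Powers

/-! ### The two types -/

section Types

variable {k : Type u} [Field k] {H : Type v} [Ring H] [HopfAlgebra k H]

theorem exists_units_zmod_of_pow_eq_self (p : ℕ) [Fact p.Prime] [CharP k p] {z : k}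
    (hz : z ≠ 0) (h : z ^ p = z) : ∃ m : (ZMod p)ˣ, z = ZMod.castHom (dvd_refl p) k m := by
  have h1 := (Subfield.mem_bot_iff_pow_eq_self k p).mpr h
  rw [← ZMod.fieldRange_castHom_eq_bot p] at h1
  obtain ⟨m, hm⟩ := h1
  have hm0 : m ≠ 0 := by
    rintro rfl
    exact hz (by rw [← hm, map_zero])
  exact ⟨Units.mk0 m hm0, hm.symm⟩

/-- The skew primitive element `x^N`, with `N` the order of `q`, lies in `kG`: otherwise it would be
a combination of `x` and `a - 1` involving `x`, while conjugation by `a` fixes it and multiplies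
`x` by `q ≠ 1`. -/
theorem exists_firstTuple {p : ℕ} [Fact p.Prime] [CharP k p] [Finite (GroupLike k H)]
    (hp : IsPointed k H) (hr : HasRank k H 1)
    (hgen : Algebra.adjoin k (coradicalFiltration k H 1 : Set H) = ⊤)
    {a : GroupLike k H} {x : H} (hx : x ∈ skewPrimitives a 1) (hx0 : x ∉ grpSpan k H) {q : k}
    (hq : (a : H) * x * (a⁻¹ : GroupLike k H) = q • x) (hq1 : q ≠ 1) :
    ∃ R : FirstTuple k p (GroupLike k H),
      R.r = 0 ∧ R.toDatum.HasMonomialBasis ∧ Nonempty (H ≃ₐc[k] R.Hopf) := by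
  have := Fintype.ofFinite (GroupLike k H)
  have hcen := skewPoint_mem_center hp hr hx hx0
  obtain ⟨χ, c, hconj, -, -⟩ := exists_conj_eq hp hr hx hx0
  have hxne : x ≠ 0 := fun h => hx0 (h ▸ zero_mem _)
  have ha1 : a ≠ 1 := by
    rintro rfl
    rw [inv_one, val_one, one_mul, mul_one] at hq
    have h : (1 - q) • x = 0 := by rw [sub_smul, one_smul, ← hq, sub_self]
    exact hq1 (sub_eq_zero.mp ((smul_eq_zero.mp h).resolve_right hxne)).symm
  have hχa : (χ a : k) = q := by
    refine (coeffs_eq_of_smul_add_eq (a := a) hx0 (t := c a) (t' := 0) ?_).1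
    rw [← hconj, hq, zero_smul, add_zero]
  -- Conjugation by `a` commutes with conjugation by `g`, and fixes `a - 1` but not `x`.
  have hc0 : ∀ g, c g = 0 := by
    intro g
    have h1 : (a : H) * ((g : H) * x * (g⁻¹ : GroupLike k H)) * (a⁻¹ : GroupLike k H) =
        q • ((g : H) * x * (g⁻¹ : GroupLike k H)) := by
      have hag : (a : H) * g = g * a :=
        congrArg GroupLike.val (Subgroup.mem_center_iff.mp hcen g).symm
      have hag' : ((g⁻¹ : GroupLike k H) : H) * (a⁻¹ : GroupLike k H) =
          (a⁻¹ : GroupLike k H) * (g⁻¹ : GroupLike k H) := by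
        rw [← val_mul, ← val_mul, ← mul_inv_rev, ← mul_inv_rev,
          Subgroup.mem_center_iff.mp hcen g]
      rw [← mul_assoc, ← mul_assoc, hag, mul_assoc, hag', ← mul_assoc, mul_assoc (g : H),
        mul_assoc (g : H), hq, mul_smul_comm, smul_mul_assoc]
    rw [hconj g, mul_add, add_mul, mul_smul_comm, smul_mul_assoc, hq, mul_smul_comm,
      smul_mul_assoc, conj_central_sub_one hcen, smul_add, smul_smul, smul_smul,
      smul_smul] at h1
    have h2 := (coeffs_eq_of_smul_add_eq hx0 h1).2
    have h3 := (smul_eq_zero.mp h2).resolve_right (val_sub_one_ne_zero ha1)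
    have h4 : (1 - q) * c g = 0 := by rw [← h3]; ring
    exact (mul_eq_zero.mp h4).resolve_left (sub_ne_zero.mpr hq1.symm)
  have hconj' : ∀ g : GroupLike k H, (g : H) * x * (g⁻¹ : GroupLike k H) = (χ g : k) • x := by
    intro g
    rw [hconj, hc0, zero_smul, add_zero]
  set n := orderOf (χ a) * p ^ 0 with hn
  have hN : 0 < orderOf (χ a) :=
    orderOf_pos_iff.mpr (MonoidHom.isOfFinOrder χ (isOfFinOrder_of_finite a))
  have hprim : IsPrimitiveRoot (χ a : k) (orderOf (χ a)) :=
    IsPrimitiveRoot.coe_units_iff.mpr (IsPrimitiveRoot.orderOf (χ a))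
  have hmem := pow_mem_skewPrimitives p hx (mul_eq_smul_of_conj_eq_smul (hconj' a)) hN hprim 0
  rw [← hn] at hmem
  have hxn : ∀ g : GroupLike k H, (g : H) * x ^ n * (g⁻¹ : GroupLike k H) =
      ((χ g : k) ^ n) • x ^ n := by
    intro g
    rw [← conj_pow, hconj', smul_pow]
  have hqn : (χ a : k) ^ n = 1 := by rw [hn, pow_zero, mul_one, hprim.pow_eq_one]
  have hspan : x ^ n ∈ grpSpan k H := by
    by_contra hnot
    have han := eq_of_mem_skewPrimitives hp hr hx hx0 hmem hnot
    rw [han] at hmem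
    obtain ⟨β, t, hβ⟩ := exists_eq_smul_add_smul hp hr hx hx0 hmem
    have h1 := hxn a
    rw [hqn, one_smul, hβ, mul_add, add_mul, mul_smul_comm, smul_mul_assoc, hq, mul_smul_comm,
      smul_mul_assoc, conj_central_sub_one hcen, smul_smul] at h1
    have h2 := (coeffs_eq_of_smul_add_eq hx0 h1).1
    have h3 : β * (q - 1) = 0 := by rw [mul_sub, h2]; ring
    have h4 : β = 0 := (mul_eq_zero.mp h3).resolve_right (sub_ne_zero.mpr hq1)
    apply hnot
    rw [hβ, h4, zero_smul, zero_add]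
    exact Submodule.smul_mem _ _ (val_sub_one_mem_grpSpan a)
  obtain ⟨α, hα, hα0⟩ : ∃ α : k, x ^ n = α • (((a ^ n : GroupLike k H) : H) - 1) ∧
      (a ^ n = 1 → α = 0) := by
    have h := eq_smul_of_mem_skewPrimitives_of_mem_grpSpan hmem hspan
    by_cases h1 : a ^ n = 1
    · refine ⟨0, ?_, fun _ => rfl⟩
      rw [h, h1, val_one, sub_self, smul_zero, smul_zero]
    · exact ⟨_, h, fun h' => absurd h' h1⟩
  let R : FirstTuple k p (GroupLike k H) :=
    { χ := χ
      a := a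
      r := 0
      αneg := α
      α := Fin.elim0
      a_central := hcen
      χ_a := fun h => hq1 (by rw [← hχa, h, Units.val_one])
      αneg_eq_zero := hα0
      cond₁ := fun i => i.elim0
      cond₂ := by
        intro hne g
        have han : ((a ^ n : GroupLike k H) : H) - 1 ≠ 0 :=
          val_sub_one_ne_zero fun h => hne (hα0 h)
        have hcen' : a ^ n ∈ Subgroup.center (GroupLike k H) := pow_mem hcen n
        have h1 := hxn g
        rw [hα, mul_smul_comm, smul_mul_assoc, conj_central_sub_one hcen', smul_smul,
          ← sub_eq_zero, ← sub_smul] at h1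
        have h2 := (smul_eq_zero.mp h1).resolve_right han
        have h3 : α * (1 - (χ g : k) ^ n) = 0 := by rw [← h2]; ring
        have h4 := sub_eq_zero.mp ((mul_eq_zero.mp h3).resolve_left hne)
        exact Units.ext (by rw [Units.val_pow_eq_pow_val, Units.val_one]; exact h4.symm) }
  refine ⟨R, rfl, Datum.hasMonomialBasis_and_nonempty_bialgEquiv hp hr hgen R.toDatum
    (x := x) hx hx0 ?_ ?_ ?_⟩
  · intro g
    rw [show R.toDatum.c g = 0 from rfl, zero_smul, add_zero]
    exact hconj' g
  · have h : ∑ i, R.toDatum.α i • x ^ (R.toDatum.N * p ^ (i : ℕ)) = 0 :=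
      Finset.sum_eq_zero fun i _ => (i : Fin 0).elim0
    rw [h, add_zero]
    exact hα
  · intro j hj hjn
    refine gaussInt_ne_zero hprim hj ?_
    have h : R.toDatum.n = orderOf (χ a) * p ^ 0 := rfl
    rwa [h, pow_zero, mul_one] at hjn

/-- If a nontrivial skew primitive element commutes with `a`, then some nontrivial skew primitive
element `y` commuting with `a` satisfies `y^p = 0` or `y^p = y + α (a^p - 1)`: in the first case
a multiple of `a - 1` is added, in the second the element is rescaled. -/
theorem exists_pow_eq [IsAlgClosed k] {p : ℕ} [Fact p.Prime] [CharP k p]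
    [Finite (GroupLike k H)] (hp : IsPointed k H) (hr : HasRank k H 1)
    {a : GroupLike k H} {x : H} (hx : x ∈ skewPrimitives a 1) (hx0 : x ∉ grpSpan k H)
    (hax : Commute x (a : H)) :
    ∃ y ∈ skewPrimitives a 1, y ∉ grpSpan k H ∧ Commute y (a : H) ∧
      (y ^ p = 0 ∨ a ^ p = a ∧ ∃ α : k, y ^ p = α • (((a ^ p : GroupLike k H) : H) - 1) + y) := by
  have := Fintype.ofFinite (GroupLike k H)
  have hpp : p.Prime := Fact.out
  have hmem : x ^ p ∈ skewPrimitives (a ^ p) 1 := by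
    have h := pow_mem_skewPrimitives p hx (q := 1) (by rw [one_smul]; exact hax.eq.symm) one_pos
      IsPrimitiveRoot.one 1
    rwa [one_mul, pow_one] at h
  by_cases hspan : x ^ p ∈ grpSpan k H
  · have hα := eq_smul_of_mem_skewPrimitives_of_mem_grpSpan hmem hspan
    obtain ⟨s, hs⟩ := IsAlgClosed.exists_pow_nat_eq (-coeff (a ^ p) (x ^ p)) hpp.pos
    refine ⟨(1 : k) • x + s • ((a : H) - 1), ?_, ?_, ?_, Or.inl ?_⟩
    · exact add_mem_skewPrimitives (smul_mem_skewPrimitives _ hx)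
        (smul_mem_skewPrimitives _ (val_sub_one_mem_skewPrimitives a))
    · intro h
      have h1 := sub_mem h (Submodule.smul_mem _ s (val_sub_one_mem_grpSpan a))
      rw [add_sub_cancel_right, one_smul] at h1
      exact hx0 h1
    · exact (hax.smul_left _).add_left
        (((Commute.refl _).sub_left (Commute.one_left _)).smul_left _)
    · rw [smul_add_smul_sub_one_pow p hax, one_pow, one_smul, hs, neg_smul, ← hα, add_neg_cancel]
  · have hap := eq_of_mem_skewPrimitives hp hr hx hx0 hmem hspan
    rw [hap] at hmem
    obtain ⟨β, t, hβ⟩ := exists_eq_smul_add_smul hp hr hx hx0 hmem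
    have hβ0 : β ≠ 0 := by
      rintro rfl
      apply hspan
      rw [hβ, zero_smul, zero_add]
      exact Submodule.smul_mem _ _ (val_sub_one_mem_grpSpan a)
    obtain ⟨l, hl⟩ := IsAlgClosed.exists_pow_nat_eq β⁻¹ (Nat.sub_pos_of_lt hpp.one_lt)
    have hl0 : l ≠ 0 := by
      rintro rfl
      rw [zero_pow (Nat.sub_pos_of_lt hpp.one_lt).ne'] at hl
      exact inv_ne_zero hβ0 hl.symm
    have hlp : l ^ p * β = l := by
      rw [← Nat.sub_add_cancel hpp.one_le, pow_succ, hl, mul_right_comm, inv_mul_cancel₀ hβ0,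
        one_mul]
    refine ⟨l • x, smul_mem_skewPrimitives _ hx, ?_, hax.smul_left _,
      Or.inr ⟨hap, l ^ p * t, ?_⟩⟩
    · intro h
      exact hx0 ((Submodule.smul_mem_iff _ hl0).mp h)
    · rw [smul_pow, hβ, smul_add, smul_smul, smul_smul, hlp, hap, add_comm]

/-- The conditions on the parameters compare the `p`-th power of `g y g⁻¹ = χ(g) y + c(g) (a - 1)`
with the conjugate of `y^p`, for an element `y` normalized as in `exists_pow_eq`. -/
theorem exists_secondTuple [IsAlgClosed k] {p : ℕ} [Fact p.Prime] [CharP k p]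
    [Finite (GroupLike k H)] (hp : IsPointed k H) (hr : HasRank k H 1)
    (hgen : Algebra.adjoin k (coradicalFiltration k H 1 : Set H) = ⊤)
    {a : GroupLike k H} {x : H} (hx : x ∈ skewPrimitives a 1) (hx0 : x ∉ grpSpan k H)
    (hax : Commute x (a : H)) :
    ∃ F : SecondTuple k p (GroupLike k H),
      F.toDatum.HasMonomialBasis ∧ Nonempty (H ≃ₐc[k] F.Hopf) := by
  have := Fintype.ofFinite (GroupLike k H)
  obtain ⟨y, hy, hy0, hya, hyp⟩ := exists_pow_eq (p := p) hp hr hx hx0 hax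
  have hcen := skewPoint_mem_center hp hr hy hy0
  obtain ⟨χ, c, hconj, hcmul, hc1⟩ := exists_conj_eq hp hr hy hy0
  have hya' : (a : H) * y * (a⁻¹ : GroupLike k H) = y := by
    rw [← hya.eq, mul_assoc, val_mul_inv, mul_one]
  have hself : (χ a : k) • y + c a • ((a : H) - 1) = (1 : k) • y + (0 : k) • ((a : H) - 1) := by
    rw [← hconj, hya', one_smul, zero_smul, add_zero]
  have hχa : χ a = 1 := Units.ext (coeffs_eq_of_smul_add_eq hy0 hself).1
  have hca : c a = 0 := by
    by_cases h1 : a = 1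
    · rw [hc1 h1]; rfl
    · have h := (coeffs_eq_of_smul_add_eq hy0 hself).2
      rw [sub_zero] at h
      exact (smul_eq_zero.mp h).resolve_right (val_sub_one_ne_zero h1)
  have hconjp : ∀ g : GroupLike k H, (g : H) * y ^ p * (g⁻¹ : GroupLike k H) =
      (χ g : k) ^ p • y ^ p + c g ^ p • (((a ^ p : GroupLike k H) : H) - 1) := by
    intro g
    rw [← conj_pow, hconj, smul_add_smul_sub_one_pow p hya]
  -- Both compatibility conditions take place in `kG`: a scalar multiple of `b - 1` vanishes there
  -- if and only if it vanishes in `H`.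
  have htransfer : ∀ (s : k) (b : GroupLike k H), s • ((b : H) - 1) = 0 →
      s • (MonoidAlgebra.of k (GroupLike k H) b - 1) = 0 := by
    intro s b h
    by_cases hb : b = 1
    · rw [hb, map_one, sub_self, smul_zero]
    · rw [(smul_eq_zero.mp h).resolve_right (val_sub_one_ne_zero hb), zero_smul]
  have main : ∀ F : SecondTuple k p (GroupLike k H), F.χ = χ → F.c = c → F.a = a →
      y ^ p = F.αneg • (((a ^ p : GroupLike k H) : H) - 1) + F.α₀ • y →
      F.toDatum.HasMonomialBasis ∧ Nonempty (H ≃ₐc[k] F.Hopf) := by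
    rintro F rfl rfl rfl hF
    have hn : F.toDatum.n = p := by
      show 1 * p ^ 1 = p
      rw [one_mul, pow_one]
    refine Datum.hasMonomialBasis_and_nonempty_bialgEquiv hp hr hgen F.toDatum
      (x := y) hy hy0 hconj ?_ ?_
    · have hsum : ∑ i, F.toDatum.α i • y ^ (F.toDatum.N * p ^ (i : ℕ)) = F.α₀ • y := by
        show ∑ i : Fin 1, F.α₀ • y ^ (1 * p ^ (i : ℕ)) = F.α₀ • y
        simp
      rw [hsum, hn]
      exact hF
    · intro j hj hjn
      have h1 : (F.toDatum.χ F.toDatum.a : k) = 1 := congrArg Units.val hχa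
      rw [hn] at hjn
      rw [h1, gaussInt]
      simp only [one_pow, Finset.sum_const, Finset.card_range, nsmul_eq_mul, mul_one]
      rw [Ne, CharP.cast_eq_zero_iff k p]
      exact Nat.not_dvd_of_pos_of_lt hj hjn
  rcases hyp with hyp | ⟨hap, α, hyp⟩
  · let F : SecondTuple k p (GroupLike k H) :=
      { χ := χ
        c := c
        a := a
        αneg := 0
        α₀ := 0
        a_central := hcen
        χ_a := hχa
        c_mul := hcmul
        c_a := hca
        α₀_mem := Or.inl rfl
        αneg_eq_zero := fun _ => rfl
        cond₁ := by
          intro _ g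
          apply htransfer
          have h := hconjp g
          rw [hyp, mul_zero, zero_mul, smul_zero, zero_add, eq_comm] at h
          rcases smul_eq_zero.mp h with h | h
          · rw [eq_zero_of_pow_eq_zero h, zero_smul]
          · rw [h, smul_zero]
        cond₂ := fun h => absurd h zero_ne_one }
    exact ⟨F, main F rfl rfl rfl (by
      rw [hyp, show F.αneg = 0 from rfl, show F.α₀ = 0 from rfl, zero_smul, zero_smul, add_zero])⟩
  · have hp2 : ∀ g, (χ g : k) ^ p = χ g ∧
        (α * ((χ g : k) - 1) + c g ^ p - c g) • ((a : H) - 1) = 0 := by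
      intro g
      have h := hconjp g
      rw [hyp, hap, mul_add, add_mul, mul_smul_comm, smul_mul_assoc, conj_central_sub_one hcen,
        hconj] at h
      have h1 : (χ g : k) • y + (α + c g) • ((a : H) - 1) =
          ((χ g : k) ^ p) • y + ((χ g : k) ^ p * α + c g ^ p) • ((a : H) - 1) := by
        rw [add_smul, add_smul, mul_smul]
        rw [smul_add] at h
        calc _ = α • ((a : H) - 1) + ((χ g : k) • y + c g • ((a : H) - 1)) := by abel
          _ = _ := h
          _ = _ := by abel
      obtain ⟨h2, h3⟩ := coeffs_eq_of_smul_add_eq hy0 h1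
      refine ⟨h2.symm, ?_⟩
      rw [← h2] at h3
      rw [← neg_eq_zero, ← neg_smul, ← h3]
      congr 1
      ring
    let F : SecondTuple k p (GroupLike k H) :=
      { χ := χ
        c := c
        a := a
        αneg := α
        α₀ := 1
        a_central := hcen
        χ_a := hχa
        c_mul := hcmul
        c_a := hca
        α₀_mem := Or.inr rfl
        αneg_eq_zero := fun h => absurd h one_ne_zero
        cond₁ := fun h => absurd h one_ne_zero
        cond₂ := fun _ => ⟨hap,
          fun g => exists_units_zmod_of_pow_eq_self p (χ g).ne_zero (hp2 g).1,
          fun g => htransfer _ _ (hp2 g).2⟩ }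
    exact ⟨F, main F rfl rfl rfl (by
      rw [hyp, show F.αneg = α from rfl, show F.α₀ = 1 from rfl, one_smul])⟩

/-- If `a x a⁻¹ = q x + t (a - 1)`, then a multiple of `a - 1` can be added to `x` so that `t`
becomes zero, unless `q = 1`, when `x` can be rescaled so that `t` becomes zero or one. -/
theorem exists_eigenvector_or_exists_unipotent [Finite (GroupLike k H)] (hp : IsPointed k H)
    (hr : HasRank k H 1) {a : GroupLike k H} {x : H} (hx : x ∈ skewPrimitives a 1)
    (hx0 : x ∉ grpSpan k H) :
    (∃ y ∈ skewPrimitives a 1, y ∉ grpSpan k H ∧ ∃ (q : k) (N : ℕ), 0 < N ∧ IsPrimitiveRoot q N ∧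
      (a : H) * y * (a⁻¹ : GroupLike k H) = q • y) ∨
    (a ≠ 1 ∧ ∃ y ∈ skewPrimitives a 1, y ∉ grpSpan k H ∧
      (a : H) * y * (a⁻¹ : GroupLike k H) = y + ((a : H) - 1)) := by
  have := Fintype.ofFinite (GroupLike k H)
  have hcen := skewPoint_mem_center hp hr hx hx0
  obtain ⟨χ, c, hconj, -, hc1⟩ := exists_conj_eq hp hr hx hx0
  have hN : 0 < orderOf (χ a) :=
    orderOf_pos_iff.mpr (MonoidHom.isOfFinOrder χ (isOfFinOrder_of_finite a))
  have hprim : IsPrimitiveRoot (χ a : k) (orderOf (χ a)) :=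
    IsPrimitiveRoot.coe_units_iff.mpr (IsPrimitiveRoot.orderOf (χ a))
  by_cases hχ : (χ a : k) = 1
  · by_cases hca : c a = 0
    · refine Or.inl ⟨x, hx, hx0, χ a, _, hN, hprim, ?_⟩
      rw [hconj, hca, zero_smul, add_zero]
    · have ha1 : a ≠ 1 := fun h => hca (by rw [hc1 h]; rfl)
      refine Or.inr ⟨ha1, (c a)⁻¹ • x, smul_mem_skewPrimitives _ hx, ?_, ?_⟩
      · intro h
        exact hx0 ((Submodule.smul_mem_iff _ (inv_ne_zero hca)).mp h)
      · rw [mul_smul_comm, smul_mul_assoc, hconj, hχ, one_smul, smul_add, smul_smul,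
          inv_mul_cancel₀ hca, one_smul]
  · refine Or.inl ⟨x + (c a / ((χ a : k) - 1)) • ((a : H) - 1), ?_, ?_, χ a, _, hN, hprim, ?_⟩
    · exact add_mem_skewPrimitives hx
        (smul_mem_skewPrimitives _ (val_sub_one_mem_skewPrimitives a))
    · intro h
      have h1 := sub_mem h (Submodule.smul_mem _ (c a / ((χ a : k) - 1))
        (val_sub_one_mem_grpSpan a))
      rw [add_sub_cancel_right] at h1
      exact hx0 h1
    · have hne : (χ a : k) - 1 ≠ 0 := sub_ne_zero.mpr hχ
      rw [mul_add, add_mul, mul_smul_comm, smul_mul_assoc, conj_central_sub_one hcen, hconj,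
        smul_add, smul_smul, add_assoc, ← add_smul]
      congr 2
      field_simp
      ring

/-- The two alternatives exclude each other: the conjugation by `a` on the span of `x` and `a - 1`
is either diagonalizable or a nontrivial unipotent map. -/
theorem not_eigenvector_and_unipotent [Finite (GroupLike k H)] (hp : IsPointed k H)
    (hr : HasRank k H 1) {a : GroupLike k H} (ha1 : a ≠ 1) {x y : H}
    (hx : x ∈ skewPrimitives a 1) (hx0 : x ∉ grpSpan k H)
    (hxa : (a : H) * x * (a⁻¹ : GroupLike k H) = x + ((a : H) - 1))
    (hy : y ∈ skewPrimitives a 1) (hy0 : y ∉ grpSpan k H) (q : k) :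
    (a : H) * y * (a⁻¹ : GroupLike k H) ≠ q • y := by
  intro hya
  have := Fintype.ofFinite (GroupLike k H)
  have hcen := skewPoint_mem_center hp hr hx hx0
  obtain ⟨β, t, rfl⟩ := exists_eq_smul_add_smul hp hr hx hx0 hy
  have hβ : β ≠ 0 := by
    rintro rfl
    apply hy0
    rw [zero_smul, zero_add]
    exact Submodule.smul_mem _ _ (val_sub_one_mem_grpSpan a)
  rw [mul_add, add_mul, mul_smul_comm, smul_mul_assoc, hxa, mul_smul_comm, smul_mul_assoc,
    conj_central_sub_one hcen, smul_add, add_assoc, ← add_smul, smul_add, smul_smul,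
    smul_smul] at hya
  obtain ⟨h1, h2⟩ := coeffs_eq_of_smul_add_eq hx0 hya
  have hq : q = 1 := mul_right_cancel₀ hβ (by rw [one_mul, ← h1])
  have h3 := (smul_eq_zero.mp h2).resolve_right (val_sub_one_ne_zero ha1)
  rw [hq, one_mul, add_sub_cancel_right] at h3
  exact hβ h3

theorem mem_nontrivialSkewPrimitives_iff (hp : IsPointed k H) {a : GroupLike k H} {x : H} :
    x ∈ nontrivialSkewPrimitives a ↔ x ∈ skewPrimitives a 1 ∧ x ∉ grpSpan k H := by
  rw [nontrivialSkewPrimitives, coradical_eq_grpSpan hp]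
  rfl

end Types

end RankOne

theorem mainTheorem1 {k : Type u} [Field k] [IsAlgClosed k] (p : ℕ) [Fact p.Prime] [CharP k p]
    {H : Type v} [Ring H] [HopfAlgebra k H] [FiniteDimensional k H]
    (hpointed : RankOne.IsPointed k H) (hrank : RankOne.HasRank k H 1)
    (hgen : Algebra.adjoin k (RankOne.coradicalFiltration k H 1 : Set H) = ⊤)
    (a : GroupLike k H) (ha : RankOne.IsSkewPoint a) :
    Xor
      (∃ x ∈ RankOne.nontrivialSkewPrimitives a, ∃ (q : k) (N : ℕ), 0 < N ∧ IsPrimitiveRoot q N ∧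
        (a : H) * x * ((a⁻¹ : GroupLike k H) : H) = q • x)
      (a ≠ 1 ∧ ∃ x ∈ RankOne.nontrivialSkewPrimitives a,
        (a : H) * x * ((a⁻¹ : GroupLike k H) : H) = x + ((a : H) - 1)) ∧
    (∀ x ∈ RankOne.nontrivialSkewPrimitives a, ∀ q : k,
      (a : H) * x * ((a⁻¹ : GroupLike k H) : H) = q • x →
        (q ≠ 1 → ∃ (G : Type v) (_ : Group G) (_ : Finite G) (R : RankOne.FirstTuple k p G),
          R.r = 0 ∧ R.toDatum.HasMonomialBasis ∧ Nonempty (H ≃ₐc[k] R.Hopf)) ∧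
        (q = 1 → ∃ (G : Type v) (_ : Group G) (_ : Finite G) (F : RankOne.SecondTuple k p G),
          F.toDatum.HasMonomialBasis ∧ Nonempty (H ≃ₐc[k] F.Hopf))) ∧
    ((a ≠ 1 ∧ ∃ x ∈ RankOne.nontrivialSkewPrimitives a,
        (a : H) * x * ((a⁻¹ : GroupLike k H) : H) = x + ((a : H) - 1)) →
      p ∣ orderOf a) := by
  have hfin : Finite (GroupLike k H) := RankOne.finite_groupLike
  simp only [RankOne.mem_nontrivialSkewPrimitives_iff hpointed, and_assoc]
  refine ⟨?_, ?_, ?_⟩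
  · obtain ⟨x, hx⟩ := ha
    obtain ⟨hx, hx0⟩ := (RankOne.mem_nontrivialSkewPrimitives_iff hpointed).mp hx
    refine xor_iff_or_and_not_and _ _ |>.mpr
      ⟨RankOne.exists_eigenvector_or_exists_unipotent hpointed hrank hx hx0, ?_⟩
    rintro ⟨⟨y, hy, hy0, q, N, -, -, hya⟩, ha1, z, hz, hz0, hza⟩
    exact RankOne.not_eigenvector_and_unipotent hpointed hrank ha1 hz hz0 hza hy hy0 q hya
  · rintro x ⟨hx, hx0⟩ q hq
    refine ⟨fun hq1 => ⟨GroupLike k H, inferInstance, hfin,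
      RankOne.exists_firstTuple hpointed hrank hgen hx hx0 hq hq1⟩, ?_⟩
    rintro rfl
    have hax : Commute x (a : H) := by
      have h := RankOne.mul_eq_smul_of_conj_eq_smul hq
      rw [one_smul] at h
      exact h.symm
    exact ⟨GroupLike k H, inferInstance, hfin,
      RankOne.exists_secondTuple hpointed hrank hgen hx hx0 hax⟩
  · rintro ⟨ha1, x, -, -, hxa⟩
    exact RankOne.dvd_orderOf_of_conj_eq_add p ha1 hxa
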